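/- Let $G$ be a locally compact second countable (Hausdorff) group and let $T=(T_g)_{g\in G}$ be a nonsingular action of $G$ on a standard Borel space $X$ with a $\sigma$-finite non-atomic measure $\mu$. Write $\mu\circ S$ for the measure $A\mapsto\mu(SA)$. Suppose that for every $g\in G$ we have $\frac{d\mu\circ T_g}{d\mu}-1\in L^1(X,\mu)$ (that is, $T_g\in\mathrm{Aut}_1(X,\mu)$) and $\chi(T_g):=\int_X\big(\frac{d\mu\circ T_g}{d\mu}-1\big)\,d\mu=0$. Let $X^*$ be the set of purely atomic $\sigma$-finite measures on $X$ with the smallest $\sigma$-algebra making all maps $N_A:\omega\mapsto\omega(A)$, $A$ measurable with $0<\mu(A)<\infty$, measurable, and let $\mu^*$ be the probability measure on $X^*$ for which $N_A$ has the Poisson distribution with parameter $\mu(A)$ for each such $A$, and $N_{A_1},\dots,N_{A_q}$ are independent whenever $A_1,\dots,A_q$ are disjoint such sets. The Poisson suspension $T^*=(T^*_g)_{g\in G}$ of $T$ is given by $T_g^*\omega:=\omega\circ T_g^{-1}$. Let $(g_k)_{k\in\mathbb N}$ be a dispersed sequence in $G$: for each compact $K\subset G$ there is $N$ such that $g_lg_m^{-1}\notin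 K$ whenever $l>m>N$. Suppose that $\big(\frac{d\mu}{d\mu\circ T_{g_k}^{-1}}\big)^2-1\in L^1(X,\mu)$ for every $k$, and that there are a real $\vartheta>0$ and reals $b_k$ with $0<b_k\le 1$, $\sum_k b_k=+\infty$ and $$\sum_{k} b_k^{1+\vartheta}\,\exp\Big(\int_X\Big(\Big(\frac{d\mu}{d\mu\circ T_{g_k}^{-1}}\Big)^2-1\Big)d\mu\Big)<+\infty .$$ Then each $T^*_g$ is a nonsingular transformation of $(X^*,\mu^*)$ and $$\sum_{k}\Big(\frac{d\mu^*\circ (T^*_{g_k})^{-1}}{d\mu^*}(\omega)\Big)^{\frac{2}{1+\vartheta}}=+\infty\quad\text{for } \mu^*\text{-a.e. }\omega .$$ If moreover $\vartheta\le 1$, then $T^*$ is conservative along $H=\{g_lg_m^{-1}: l>m\}$, that is, for each measurable $A\subset X^*$ with $\mu^*(A)>0$ and each compact $K\subset G$ there is $h\in H\setminus K$ with $\mu^*(T^*_hA\cap A)>0$. -/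

import Mathlib

open MeasureTheory ProbabilityTheory Filter Topology
open scoped ENNReal NNReal

namespace PoissonSuspension

section Transformations

/-- `Aut(X, μ)`: the nonsingular invertible transformations of `(X, μ)`, i.e. the Borel
automorphisms `S` of `X` for which `S` and `S⁻¹` preserve the class of `μ`-null sets. -/
def Aut {X : Type*} [MeasurableSpace X] (μ : Measure X) : Set (X ≃ᵐ X) :=
  {S | Measure.QuasiMeasurePreserving S μ μ ∧ Measure.QuasiMeasurePreserving S.symm μ μ}

/-- The measure `μ ∘ S : A ↦ μ(S A)`. -/
noncomputable def compMeasure {X : Type*} [MeasurableSpace X] (μ : Measure X) (S : X ≃ᵐ X) :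
    Measure X := μ.map S.symm

/-- `Aut₁(X, μ)`: the nonsingular transformations `S` with `dμ∘S/dμ - 1 ∈ L¹(X, μ)`. -/
def Aut1 {X : Type*} [MeasurableSpace X] (μ : Measure X) : Set (X ≃ᵐ X) :=
  {S | S ∈ Aut μ ∧ Integrable (fun x => ((compMeasure μ S).rnDeriv μ x).toReal - 1) μ}

/-- `χ(S) = ∫ (dμ∘S/dμ - 1) dμ`. -/
noncomputable def chi {X : Type*} [MeasurableSpace X] (μ : Measure X) (S : X ≃ᵐ X) : ℝ :=
  ∫ x, (((compMeasure μ S).rnDeriv μ x).toReal - 1) ∂μ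

/-- A sequence in a topological group is dispersed if for each compact `K` one has
`g_l g_m⁻¹ ∉ K` whenever `l > m` are large enough. -/
def IsDispersed {G : Type*} [Group G] [TopologicalSpace G] (g : ℕ → G) : Prop :=
  ∀ K : Set G, IsCompact K → ∃ N : ℕ, ∀ l m : ℕ, l > m → m > N → g l * (g m)⁻¹ ∉ K

/-- The action of `G` on `(Z, ν)` is conservative along `H ⊆ G`: for each measurable `A` of
positive measure and each compact `K`, some `h ∈ H \ K` satisfies `ν(hA ∩ A) > 0`. -/
def ConservativeAlong {G Z : Type*} [Group G] [TopologicalSpace G] [MeasurableSpace Z]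
    [MulAction G Z] (ν : Measure Z) (H : Set G) : Prop :=
  ∀ A : Set Z, MeasurableSet A → 0 < ν A → ∀ K : Set G, IsCompact K →
    ∃ h ∈ H \ K, 0 < ν ((fun z => h • z) '' A ∩ A)

end Transformations

section PoissonSpace

variable {X : Type*} [MeasurableSpace X]

/-- A measure is purely atomic if each measurable set of positive measure contains an atom
(on a standard Borel space atoms are points). -/
def IsPurelyAtomic (ω : Measure X) : Prop :=
  ∀ A : Set X, MeasurableSet A → ω A ≠ 0 → ∃ x ∈ A, ω {x} ≠ 0

/-- The set `X*` of purely atomic `σ`-finite measures on `X`. The measure `μ` is only used to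
define the `σ`-algebra. -/
def PoissonSpace (_μ : Measure X) : Type _ :=
  {ω : Measure X // IsPurelyAtomic ω ∧ SigmaFinite ω}

/-- The counting map `N_A : ω ↦ ω(A)`. -/
def count {μ : Measure X} (A : Set X) (ω : PoissonSpace μ) : ℝ≥0∞ := ω.1 A

/-- The smallest `σ`-algebra on `X*` making `N_A` measurable for each measurable `A` with
`0 < μ(A) < ∞`. -/
instance (μ : Measure X) : MeasurableSpace (PoissonSpace μ) :=
  ⨆ A ∈ {A : Set X | MeasurableSet A ∧ 0 < μ A ∧ μ A < ∞},
    MeasurableSpace.comap (count A) inferInstance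

lemma measurable_count {μ : Measure X} {A : Set X} (hA : MeasurableSet A) (h0 : 0 < μ A)
    (h1 : μ A < ∞) : Measurable (count A : PoissonSpace μ → ℝ≥0∞) := by
  rw [measurable_iff_comap_le]
  exact le_iSup₂_of_le A ⟨hA, h0, h1⟩ le_rfl

lemma measurable_of_measurable_count {μ : Measure X} {Ω : Type*} [MeasurableSpace Ω]
    {Φ : Ω → PoissonSpace μ} (h : ∀ A : Set X, MeasurableSet A → 0 < μ A → μ A < ∞ →
      Measurable fun w => count A (Φ w)) : Measurable Φ := by
  rw [measurable_iff_comap_le, MeasurableSpace.comap_le_iff_le_map]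
  refine iSup₂_le fun A hA => ?_
  rw [← MeasurableSpace.comap_le_iff_le_map, MeasurableSpace.comap_comp,
    ← measurable_iff_comap_le]
  exact h A hA.1 hA.2.1 hA.2.2

/-- The two conditions characterizing the distribution of the Poisson point process with
intensity `μ`. -/
structure IsPoissonLaw (μ : Measure X) (P : Measure (PoissonSpace μ)) : Prop where
  isProbabilityMeasure : IsProbabilityMeasure P
  map_count : ∀ A : Set X, MeasurableSet A → 0 < μ A → μ A < ∞ →
    P.map (count A) = (poissonMeasure (μ A).toNNReal).map (fun k : ℕ => (k : ℝ≥0∞))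
  iIndepFun_count : ∀ (q : ℕ) (A : Fin q → Set X),
    (∀ j, MeasurableSet (A j) ∧ 0 < μ (A j) ∧ μ (A j) < ∞) →
    (Pairwise fun i j => Disjoint (A i) (A j)) →
    iIndepFun (fun j => (count (A j) : PoissonSpace μ → ℝ≥0∞)) P

end PoissonSpace

section Existence

variable {X : Type*} [MeasurableSpace X]

lemma exists_prob_smul [Nonempty X] (m : Measure X) [IsFiniteMeasure m] :
    ∃ ν : Measure X, IsProbabilityMeasure ν ∧ m = m Set.univ • ν := by
  by_cases h : m = 0
  · obtain ⟨x⟩ := ‹Nonempty X›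
    exact ⟨Measure.dirac x, inferInstance, by simp [h]⟩
  · have h0 : m Set.univ ≠ 0 := by simpa using h
    refine ⟨(m Set.univ)⁻¹ • m, ⟨?_⟩, ?_⟩
    · simp [ENNReal.inv_mul_cancel h0 (measure_ne_top m _)]
    · rw [smul_smul, ENNReal.mul_inv_cancel h0 (measure_ne_top m _), one_smul]

lemma lintegral_natCast_poissonMeasure (c : ℝ≥0) :
    ∫⁻ k : ℕ, (k : ℝ≥0∞) ∂(poissonMeasure c) = c := by
  have h : ∫⁻ k : ℕ, (k : ℝ≥0∞) ∂(poissonMeasure c) =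
      ∑' k : ℕ, ENNReal.ofReal (Real.exp (-c) * c ^ k / (k.factorial)) * k := by
    rw [poissonMeasure, lintegral_sum_measure]
    simp
  rw [h, tsum_eq_zero_add' ENNReal.summable]
  have h2 : ∀ k : ℕ, ENNReal.ofReal (Real.exp (-c) * c ^ (k + 1) / ((k + 1).factorial)) *
      ((k + 1 : ℕ) : ℝ≥0∞) = c * poissonMeasure c {k} := by
    intro k
    rw [poissonMeasure_singleton, ← ENNReal.ofReal_natCast, ← ENNReal.ofReal_mul (by positivity),
      ← ENNReal.ofReal_coe_nnreal, ← ENNReal.ofReal_mul (by positivity)]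
    congr 1
    rw [Nat.factorial_succ]
    push_cast
    field_simp
    ring
  simp_rw [h2]
  rw [ENNReal.tsum_mul_left]
  have h3 : ∑' k : ℕ, poissonMeasure c {k} = 1 := by
    have := lintegral_countable' (μ := poissonMeasure c) (fun _ => 1)
    simpa using this.symm
  simp [h3]

/-- Expected value of a Poisson number of independent summands. -/
lemma lintegral_compound (c : ℝ≥0) (ν : Measure X) [IsProbabilityMeasure ν] {f : X → ℝ≥0∞}
    (hf : Measurable f) :
    ∫⁻ p : ℕ × (ℕ → X), ∑ i ∈ Finset.range p.1, f (p.2 i)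
      ∂((poissonMeasure c).prod (Measure.infinitePi fun _ : ℕ => ν)) = c * ∫⁻ x, f x ∂ν := by
  rw [lintegral_prod]
  · have : ∀ k : ℕ, ∫⁻ y : ℕ → X, ∑ i ∈ Finset.range k, f (y i)
        ∂(Measure.infinitePi fun _ : ℕ => ν) = k * ∫⁻ x, f x ∂ν := by
      intro k
      rw [lintegral_finsetSum _ (fun i _ => by fun_prop)]
      have : ∀ i : ℕ, ∫⁻ y : ℕ → X, f (y i) ∂(Measure.infinitePi fun _ : ℕ => ν)
          = ∫⁻ x, f x ∂ν := fun i =>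
        (measurePreserving_eval_infinitePi (fun _ : ℕ => ν) i).lintegral_comp hf
      simp [this]
    simp only [this]
    rw [lintegral_mul_const _ (by fun_prop), lintegral_natCast_poissonMeasure]
  · refine (measurable_from_prod_countable_right fun k => ?_).aemeasurable
    dsimp only
    fun_prop

lemma measurable_compound {f : X → ℝ} (hf : Measurable f) :
    Measurable fun p : ℕ × (ℕ → X) => ∑ i ∈ Finset.range p.1, f (p.2 i) := by
  refine measurable_from_prod_countable_right fun k => ?_
  dsimp only
  fun_prop

/-- Characteristic function of a compound Poisson variable. -/
lemma integral_cexp_compound (c : ℝ≥0) (ν : Measure X) [IsProbabilityMeasure ν] {f : X → ℝ}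
    (hf : Measurable f) :
    ∫ p : ℕ × (ℕ → X), Complex.exp ((∑ i ∈ Finset.range p.1, f (p.2 i) : ℝ) * Complex.I)
      ∂((poissonMeasure c).prod (Measure.infinitePi fun _ : ℕ => ν)) =
      Complex.exp (c * (∫ x, Complex.exp (f x * Complex.I) ∂ν - 1)) := by
  set z := ∫ x, Complex.exp (f x * Complex.I) ∂ν with hz
  rw [integral_prod]
  · have : ∀ k : ℕ, ∫ y : ℕ → X, Complex.exp ((∑ i ∈ Finset.range k, f (y i) : ℝ) * Complex.I)
        ∂(Measure.infinitePi fun _ : ℕ => ν) = z ^ k := by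
      intro k
      have h1 := integral_restrict_infinitePi (μ := fun _ : ℕ => ν) (s := Finset.range k)
        (f := fun y => ∏ i, Complex.exp (f (y i) * Complex.I))
        (Measurable.aestronglyMeasurable (by fun_prop))
      rw [integral_fintype_prod_eq_pow (fun x => Complex.exp (f x * Complex.I))] at h1
      simp only [Fintype.card_coe, Finset.card_range] at h1
      rw [hz, ← h1]
      congr 1
      ext y
      rw [Complex.ofReal_sum, Finset.sum_mul, Complex.exp_sum, ← Finset.prod_coe_sort]
      rfl
    simp only [this]
    rw [integral_poissonMeasure]
    calc ∑' k : ℕ, (Real.exp (-c) * c ^ k / k.factorial) • z ^ k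
        = ∑' k : ℕ, (Real.exp (-c) : ℂ) * ((c * z) ^ k / k.factorial) := by
          congr with k
          rw [Complex.real_smul]
          push_cast
          ring
      _ = (Real.exp (-c) : ℂ) * Complex.exp (c * z) := by
          rw [tsum_mul_left, (NormedSpace.expSeries_div_hasSum_exp ((c : ℂ) * z)).tsum_eq,
            Complex.exp_eq_exp_ℂ]
      _ = _ := by
          rw [Complex.ofReal_exp, ← Complex.exp_add]
          congr 1
          push_cast
          ring
  · refine Integrable.of_bound (C := 1) ?_ (ae_of_all _ fun p => ?_)
    · have := measurable_compound hf
      exact Measurable.aestronglyMeasurable (by fun_prop)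
    · rw [Complex.norm_exp_ofReal_mul_I]


/-- The Poisson point process built from a partition of `X` into pieces of finite measure. -/
noncomputable def superposition (S : ℕ → Set X) (w : ℕ → ℕ × (ℕ → X)) : Measure X :=
  Measure.sum fun n => (∑ i ∈ Finset.range (w n).1, Measure.dirac ((w n).2 i)).restrict (S n)

lemma superposition_apply {S : ℕ → Set X} (hS : ∀ n, MeasurableSet (S n))
    (w : ℕ → ℕ × (ℕ → X)) {A : Set X} (hA : MeasurableSet A) :
    superposition S w A = ∑' n, ∑ i ∈ Finset.range (w n).1,
      (A ∩ S n).indicator (1 : X → ℝ≥0∞) ((w n).2 i) := by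
  rw [superposition, Measure.sum_apply _ hA]
  congr with n
  rw [Measure.restrict_apply hA, Measure.finsetSum_apply]
  exact Finset.sum_congr rfl fun i _ => Measure.dirac_apply' _ (hA.inter (hS n))

lemma measurable_superposition_apply {S : ℕ → Set X} (hS : ∀ n, MeasurableSet (S n))
    {A : Set X} (hA : MeasurableSet A) : Measurable fun w => superposition S w A := by
  simp_rw [superposition_apply hS _ hA]
  refine Measurable.tsum fun n => ?_
  have h : Measurable fun p : ℕ × (ℕ → X) => ∑ i ∈ Finset.range p.1,
      (A ∩ S n).indicator (1 : X → ℝ≥0∞) (p.2 i) := by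
    have := (measurable_one (α := ℝ≥0∞) (β := X)).indicator (hA.inter (hS n))
    refine measurable_from_prod_countable_right fun k => ?_
    dsimp only
    fun_prop
  exact h.comp (measurable_pi_apply n)

lemma superposition_apply_lt_top {S : ℕ → Set X} (hS : ∀ n, MeasurableSet (S n))
    (hd : Pairwise fun i j => Disjoint (S i) (S j)) (w : ℕ → ℕ × (ℕ → X)) (m : ℕ) :
    superposition S w (S m) < ∞ := by
  rw [superposition, Measure.sum_apply _ (hS m), tsum_eq_single m]
  · exact measure_lt_top _ _
  · intro n hn
    rw [Measure.restrict_apply (hS m), (hd hn.symm).inter_eq, measure_empty]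

variable {μ : Measure X} {S : ℕ → Set X} {ν : ℕ → Measure X} {c : ℕ → ℝ≥0}

/-- Law of the points and their numbers on all the pieces. -/
noncomputable def baseLaw (c : ℕ → ℝ≥0) (ν : ℕ → Measure X) [∀ n, IsProbabilityMeasure (ν n)] :
    Measure (ℕ → ℕ × (ℕ → X)) :=
  Measure.infinitePi fun n => (poissonMeasure (c n)).prod (Measure.infinitePi fun _ : ℕ => ν n)

instance [∀ n, IsProbabilityMeasure (ν n)] : IsProbabilityMeasure (baseLaw c ν) := by
  unfold baseLaw; infer_instance

lemma lintegral_superposition [∀ n, IsProbabilityMeasure (ν n)]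
    (hS : ∀ n, MeasurableSet (S n)) (hd : Pairwise fun i j => Disjoint (S i) (S j))
    (hU : ⋃ n, S n = Set.univ) (hν : ∀ n, μ.restrict (S n) = (c n : ℝ≥0∞) • ν n)
    {A : Set X} (hA : MeasurableSet A) :
    ∫⁻ w, superposition S w A ∂(baseLaw c ν) = μ A := by
  simp_rw [superposition_apply hS _ hA]
  have hm : ∀ n, Measurable ((A ∩ S n).indicator (1 : X → ℝ≥0∞)) := fun n =>
    measurable_one.indicator (hA.inter (hS n))
  have h : ∀ n, Measurable fun p : ℕ × (ℕ → X) => ∑ i ∈ Finset.range p.1,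
      (A ∩ S n).indicator (1 : X → ℝ≥0∞) (p.2 i) := by
    intro n
    have := hm n
    refine measurable_from_prod_countable_right fun k => ?_
    dsimp only
    fun_prop
  have hc : ∀ n, Measurable fun w : ℕ → ℕ × (ℕ → X) => ∑ i ∈ Finset.range (w n).1,
      (A ∩ S n).indicator (1 : X → ℝ≥0∞) ((w n).2 i) := fun n =>
    (h n).comp (measurable_pi_apply n)
  rw [lintegral_tsum fun n => (hc n).aemeasurable]
  have h2 : ∀ n, ∫⁻ w, (fun p : ℕ × (ℕ → X) => ∑ i ∈ Finset.range p.1,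
      (A ∩ S n).indicator (1 : X → ℝ≥0∞) (p.2 i)) (w n) ∂(baseLaw c ν) = μ (A ∩ S n) := by
    intro n
    rw [baseLaw, (measurePreserving_eval_infinitePi (fun n => (poissonMeasure (c n)).prod
      (Measure.infinitePi fun _ : ℕ => ν n)) n).lintegral_comp (h n),
      lintegral_compound _ _ (hm n), lintegral_indicator_one (hA.inter (hS n))]
    have h3 := congrArg (fun m : Measure X => m (A ∩ S n)) (hν n)
    simp only [Measure.smul_apply, smul_eq_mul, Measure.restrict_apply (hA.inter (hS n)),
      Set.inter_assoc, Set.inter_self] at h3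
    exact h3.symm
  simp only at h2
  simp_rw [h2]
  rw [← measure_iUnion (fun i j hij => (hd hij).mono Set.inter_subset_right
    Set.inter_subset_right) (fun n => hA.inter (hS n)), ← Set.inter_iUnion, hU, Set.inter_univ]

/-- Joint characteristic function of the counts of finitely many disjoint sets. -/
lemma integral_cexp_superposition [∀ n, IsProbabilityMeasure (ν n)]
    (hS : ∀ n, MeasurableSet (S n)) (hd : Pairwise fun i j => Disjoint (S i) (S j))
    (hU : ⋃ n, S n = Set.univ) (hν : ∀ n, μ.restrict (S n) = (c n : ℝ≥0∞) • ν n)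
    {ι : Type*} [Fintype ι] {A : ι → Set X} (hA : ∀ j, MeasurableSet (A j))
    (hfin : ∀ j, μ (A j) ≠ ∞) (hAd : Pairwise fun i j => Disjoint (A i) (A j)) (t : ι → ℝ) :
    ∫ w, Complex.exp ((∑ j, t j * (superposition S w (A j)).toReal : ℝ) * Complex.I)
      ∂(baseLaw c ν) =
      Complex.exp (∑ j, ((μ (A j)).toReal : ℂ) * (Complex.exp (t j * Complex.I) - 1)) := by
  classical
  let f : ℕ → X → ℝ := fun n x => ∑ j, t j * (A j ∩ S n).indicator (1 : X → ℝ) x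
  have hf : ∀ n, Measurable (f n) := fun n => by
    have : ∀ j, Measurable ((A j ∩ S n).indicator (1 : X → ℝ)) := fun j =>
      measurable_one.indicator ((hA j).inter (hS n))
    fun_prop
  let F : ℕ → ℕ × (ℕ → X) → ℝ := fun n p => ∑ i ∈ Finset.range p.1, f n (p.2 i)
  have hF : ∀ n, Measurable (F n) := fun n => measurable_compound (hf n)
  have hone : ∀ n, ∫ p, Complex.exp ((F n p : ℝ) * Complex.I)
      ∂((poissonMeasure (c n)).prod (Measure.infinitePi fun _ : ℕ => ν n)) =
      Complex.exp (∑ j, ((μ (A j ∩ S n)).toReal : ℂ) * (Complex.exp (t j * Complex.I) - 1)) := by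
    intro n
    rw [integral_cexp_compound (c n) (ν n) (hf n)]
    congr 1
    have hpt : ∀ x, Complex.exp (f n x * Complex.I) - 1 =
        ∑ j, (A j ∩ S n).indicator (fun _ => Complex.exp (t j * Complex.I) - 1) x := by
      intro x
      by_cases hx : ∃ j, x ∈ A j ∩ S n
      · obtain ⟨j, hj⟩ := hx
        have hne : ∀ i, i ≠ j → x ∉ A i ∩ S n := fun i hi h =>
          (Set.disjoint_left.1 (hAd hi)) h.1 hj.1
        have h1 : f n x = t j := by
          simp only [f]
          rw [Finset.sum_eq_single j (fun i _ hi => by simp [hne i hi]) (by simp)]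
          simp [hj]
        rw [h1, Finset.sum_eq_single j (fun i _ hi => by
          rw [Set.indicator_of_notMem (hne i hi)]) (by simp), Set.indicator_of_mem hj]
      · push Not at hx
        have h1 : f n x = 0 := Finset.sum_eq_zero fun j _ => by
          rw [Set.indicator_of_notMem (hx j), mul_zero]
        rw [h1, Finset.sum_eq_zero fun j _ => by rw [Set.indicator_of_notMem (hx j)]]
        simp
    have hi : Integrable (fun x => Complex.exp (f n x * Complex.I)) (ν n) := by
      refine Integrable.of_bound (C := 1) (Measurable.aestronglyMeasurable ?_)
        (ae_of_all _ fun x => by rw [Complex.norm_exp_ofReal_mul_I])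
      have := hf n
      fun_prop
    have h1 : ∫ x, Complex.exp (f n x * Complex.I) ∂(ν n) - 1 =
        ∫ x, (Complex.exp (f n x * Complex.I) - 1) ∂(ν n) := by
      rw [integral_sub hi (integrable_const _)]
      simp
    rw [h1]
    simp_rw [hpt]
    rw [integral_finsetSum _ fun j _ => (integrable_const _).indicator ((hA j).inter (hS n)),
      Finset.mul_sum]
    refine Finset.sum_congr rfl fun j _ => ?_
    rw [integral_indicator_const _ ((hA j).inter (hS n)), Complex.real_smul, ← mul_assoc]
    congr 1
    have h3 := congrArg (fun m : Measure X => (m (A j ∩ S n)).toReal) (hν n)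
    simp only [Measure.smul_apply, smul_eq_mul, Measure.restrict_apply ((hA j).inter (hS n)),
      Set.inter_assoc, Set.inter_self, ENNReal.toReal_mul, ENNReal.coe_toReal] at h3
    rw [h3, measureReal_def]
    push_cast
    rfl
  have hpart : ∀ M : ℕ, ∫ w, Complex.exp ((∑ n ∈ Finset.range M, F n (w n) : ℝ) * Complex.I)
      ∂(baseLaw c ν) = Complex.exp (∑ j, ((∑ n ∈ Finset.range M, (μ (A j ∩ S n)).toReal : ℝ) : ℂ)
        * (Complex.exp (t j * Complex.I) - 1)) := by
    intro M
    have h1 := integral_restrict_infinitePi (μ := fun n => (poissonMeasure (c n)).prod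
      (Measure.infinitePi fun _ : ℕ => ν n)) (s := Finset.range M)
      (f := fun y => ∏ n : Finset.range M, Complex.exp ((F n (y n) : ℝ) * Complex.I))
      (Measurable.aestronglyMeasurable (by fun_prop))
    rw [integral_fintype_prod_eq_prod (fun (n : Finset.range M) (p : ℕ × (ℕ → X)) =>
      Complex.exp ((F n p : ℝ) * Complex.I))] at h1
    simp_rw [hone] at h1
    have h2 : ∀ w : ℕ → ℕ × (ℕ → X),
        Complex.exp ((∑ n ∈ Finset.range M, F n (w n) : ℝ) * Complex.I) =
        ∏ n : Finset.range M, Complex.exp ((F n ((Finset.range M).restrict w n) : ℝ)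
          * Complex.I) := by
      intro w
      rw [Complex.ofReal_sum, Finset.sum_mul, Complex.exp_sum, ← Finset.prod_coe_sort]
      rfl
    simp_rw [h2]
    rw [baseLaw, h1, ← Complex.exp_sum, Finset.sum_comm]
    congr 1
    refine Finset.sum_congr rfl fun j _ => ?_
    rw [Complex.ofReal_sum, Finset.sum_mul]
    exact Finset.sum_coe_sort (Finset.range M) fun n =>
      ((μ (A j ∩ S n)).toReal : ℂ) * (Complex.exp (t j * Complex.I) - 1)
  have hsum : ∀ j, HasSum (fun n => (μ (A j ∩ S n)).toReal) (μ (A j)).toReal := by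
    intro j
    have h1 : μ (A j) = ∑' n, μ (A j ∩ S n) := by
      rw [← measure_iUnion (fun i k hik => (hd hik).mono Set.inter_subset_right
        Set.inter_subset_right) (fun n => (hA j).inter (hS n)), ← Set.inter_iUnion, hU,
        Set.inter_univ]
    rw [h1, ENNReal.tsum_toReal_eq fun n =>
      ((measure_mono Set.inter_subset_left).trans_lt (hfin j).lt_top).ne]
    exact (ENNReal.summable_toReal (h1 ▸ hfin j)).hasSum
  have hae : ∀ᵐ w ∂(baseLaw c ν), ∀ j, superposition S w (A j) < ∞ := by
    rw [ae_all_iff]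
    intro j
    refine ae_lt_top (measurable_superposition_apply hS (hA j)) ?_
    rw [lintegral_superposition hS hd hU hν (hA j)]
    exact hfin j
  have hlim := tendsto_integral_of_dominated_convergence (μ := baseLaw c ν)
    (F := fun (M : ℕ) w => Complex.exp ((∑ n ∈ Finset.range M, F n (w n) : ℝ) * Complex.I))
    (f := fun w => Complex.exp ((∑ j, t j * (superposition S w (A j)).toReal : ℝ) * Complex.I))
    (fun _ => (1 : ℝ)) (fun M => Measurable.aestronglyMeasurable (by fun_prop))
    (integrable_const _)
    (fun M => ae_of_all _ fun w => by rw [Complex.norm_exp_ofReal_mul_I])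
    (by
      filter_upwards [hae] with w hw
      have hs : HasSum (fun n => F n (w n)) (∑ j, t j * (superposition S w (A j)).toReal) := by
        have h1 : ∀ n, F n (w n) = ∑ j, t j * (∑ i ∈ Finset.range (w n).1,
            (A j ∩ S n).indicator (1 : X → ℝ≥0∞) ((w n).2 i)).toReal := by
          intro n
          simp only [F, f]
          rw [Finset.sum_comm]
          refine Finset.sum_congr rfl fun j _ => ?_
          have hind : ∀ x, (A j ∩ S n).indicator (1 : X → ℝ≥0∞) x ≠ ∞ := fun x => by
            by_cases hx : x ∈ A j ∩ S n <;> simp [hx]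
          rw [ENNReal.toReal_sum fun i _ => hind _, Finset.mul_sum]
          refine Finset.sum_congr rfl fun i _ => ?_
          by_cases hx : (w n).2 i ∈ A j ∩ S n
          · rw [Set.indicator_of_mem hx, Set.indicator_of_mem hx]; simp
          · rw [Set.indicator_of_notMem hx, Set.indicator_of_notMem hx]; simp
        simp_rw [h1]
        refine hasSum_sum fun j _ => HasSum.mul_left _ ?_
        have h2 := superposition_apply hS w (hA j)
        have h3 := hw j
        rw [h2] at h3 ⊢
        rw [ENNReal.tsum_toReal_eq fun n => ENNReal.ne_top_of_tsum_ne_top h3.ne n]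
        exact (ENNReal.summable_toReal h3.ne).hasSum
      exact (Complex.continuous_exp.tendsto _).comp
        (((Complex.continuous_ofReal.tendsto _).comp hs.tendsto_sum_nat).mul_const _))
  simp_rw [hpart] at hlim
  refine tendsto_nhds_unique hlim ((Complex.continuous_exp.tendsto _).comp ?_)
  refine tendsto_finsetSum _ fun j _ => Tendsto.mul_const _ ?_
  exact (Complex.continuous_ofReal.tendsto _).comp (hsum j).tendsto_sum_nat


lemma isPurelyAtomic_superposition (hS : ∀ n, MeasurableSet (S n)) (w : ℕ → ℕ × (ℕ → X)) :
    IsPurelyAtomic (superposition S w) := by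
  intro A hA h
  rw [superposition_apply hS w hA, Ne, ENNReal.tsum_eq_zero, not_forall] at h
  obtain ⟨n, hn⟩ := h
  obtain ⟨i, hi, hin⟩ := Finset.exists_ne_zero_of_sum_ne_zero hn
  have hx : (w n).2 i ∈ A ∩ S n := Set.mem_of_indicator_ne_zero hin
  refine ⟨(w n).2 i, hx.1, fun h0 => ?_⟩
  have h1 : ((∑ i ∈ Finset.range (w n).1, Measure.dirac ((w n).2 i)).restrict (S n))
      {(w n).2 i} = 0 :=
    le_antisymm ((Measure.le_sum (fun n => (∑ i ∈ Finset.range (w n).1,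
      Measure.dirac ((w n).2 i)).restrict (S n)) n _).trans h0.le) zero_le
  rw [Measure.restrict_apply' (hS n), Set.inter_eq_left.2 (Set.singleton_subset_iff.2 hx.2),
    Measure.finsetSum_apply, Finset.sum_eq_zero_iff] at h1
  have h2 := h1 i hi
  rw [Measure.dirac_apply_of_mem (Set.mem_singleton _)] at h2
  exact one_ne_zero h2

lemma sigmaFinite_superposition (hS : ∀ n, MeasurableSet (S n))
    (hd : Pairwise fun i j => Disjoint (S i) (S j)) (hU : ⋃ n, S n = Set.univ)
    (w : ℕ → ℕ × (ℕ → X)) : SigmaFinite (superposition S w) :=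
  ⟨⟨{ set := S
      set_mem := fun _ => trivial
      finite := fun n => superposition_apply_lt_top hS hd w n
      spanning := hU }⟩⟩

theorem exists_isPoissonLaw (μ : Measure X) [SigmaFinite μ] : ∃ P, IsPoissonLaw μ P := by
  rcases isEmpty_or_nonempty X with hX | hX
  · have hz : ∀ A : Set X, ¬ 0 < μ A := fun A => by simp [Set.eq_empty_of_isEmpty A]
    let z : PoissonSpace μ := ⟨0, fun A _ h => absurd rfl h, inferInstance⟩
    have hz1 : IsProbabilityMeasure (Measure.dirac z) := inferInstance
    refine ⟨Measure.dirac z, hz1, fun A _ h => absurd h (hz A), fun q A hA _ => ?_⟩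
    have : IsEmpty (Fin q) := ⟨fun j => hz _ (hA j).2.1⟩
    rw [iIndepFun_iff_measure_inter_preimage_eq_mul]
    intro s _ _
    simp [Finset.eq_empty_of_isEmpty s]
  let S : ℕ → Set X := disjointed (spanningSets μ)
  have hS : ∀ n, MeasurableSet (S n) := MeasurableSet.disjointed (measurableSet_spanningSets μ)
  have hd : Pairwise fun i j => Disjoint (S i) (S j) := disjoint_disjointed _
  have hU : ⋃ n, S n = Set.univ := by rw [iUnion_disjointed, iUnion_spanningSets]
  have hSf : ∀ n, μ (S n) < ∞ := fun n =>
    (measure_mono (disjointed_subset _ _)).trans_lt (measure_spanningSets_lt_top μ n)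
  have hex : ∀ n, ∃ ν : Measure X, IsProbabilityMeasure ν ∧ μ.restrict (S n) = μ (S n) • ν := by
    intro n
    have : IsFiniteMeasure (μ.restrict (S n)) := ⟨by simpa using hSf n⟩
    simpa using exists_prob_smul (μ.restrict (S n))
  choose ν hν hνS using hex
  let c : ℕ → ℝ≥0 := fun n => (μ (S n)).toNNReal
  have hc : ∀ n, μ.restrict (S n) = (c n : ℝ≥0∞) • ν n := fun n => by
    rw [ENNReal.coe_toNNReal (hSf n).ne]; exact hνS n
  let Φ : (ℕ → ℕ × (ℕ → X)) → PoissonSpace μ := fun w =>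
    ⟨superposition S w, isPurelyAtomic_superposition hS w, sigmaFinite_superposition hS hd hU w⟩
  have hΦ : Measurable Φ := measurable_of_measurable_count fun A hA _ _ =>
    measurable_superposition_apply hS hA
  have hreal : ∀ A : Set X, MeasurableSet A → μ A < ∞ →
      (baseLaw c ν).map (fun w => (superposition S w A).toReal) =
        (poissonMeasure (μ A).toNNReal).map (fun k : ℕ => (k : ℝ)) := by
    intro A hA hAf
    have hm := (measurable_superposition_apply hS hA).ennreal_toReal
    have := Measure.isProbabilityMeasure_map (μ := baseLaw c ν) hm.aemeasurable
    refine Measure.ext_of_charFun (funext fun t => ?_)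
    rw [charFun_map_cast_poissonMeasure, charFun_apply, integral_map hm.aemeasurable
      (Measurable.aestronglyMeasurable (by fun_prop))]
    have h := integral_cexp_superposition hS hd hU hc (ι := Unit) (A := fun _ => A)
      (fun _ => hA) (fun _ => hAf.ne) (fun i j hij => absurd rfl hij) (fun _ => t)
    simpa [ENNReal.coe_toNNReal_eq_toReal] using h
  have hae : ∀ A : Set X, MeasurableSet A → μ A < ∞ →
      ∀ᵐ w ∂(baseLaw c ν), superposition S w A < ∞ := by
    intro A hA hAf
    refine ae_lt_top (measurable_superposition_apply hS hA) ?_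
    rw [lintegral_superposition hS hd hU hc hA]
    exact hAf.ne
  refine ⟨(baseLaw c ν).map Φ, Measure.isProbabilityMeasure_map hΦ.aemeasurable, ?_, ?_⟩
  · intro A hA h0 h1
    rw [Measure.map_map (measurable_count hA h0 h1) hΦ]
    have h2 : (count A ∘ Φ) =ᵐ[baseLaw c ν]
        fun w => ENNReal.ofReal (superposition S w A).toReal := by
      filter_upwards [hae A hA h1] with w hw
      exact (ENNReal.ofReal_toReal hw.ne).symm
    rw [Measure.map_congr h2]
    have hm := (measurable_superposition_apply hS hA).ennreal_toReal
    have h3 := Measure.map_map (μ := baseLaw c ν) ENNReal.measurable_ofReal hm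
    rw [Function.comp_def] at h3
    rw [← h3, hreal A hA h1, Measure.map_map ENNReal.measurable_ofReal (by fun_prop)]
    congr 1
    ext k
    simp
  · intro q A hA hAd
    have hm : ∀ j, Measurable fun w => (superposition S w (A j)).toReal := fun j =>
      (measurable_superposition_apply hS (hA j).1).ennreal_toReal
    have hm' : Measurable fun w => WithLp.toLp 2 fun j => (superposition S w (A j)).toReal :=
      (WithLp.measurable_toLp 2 _).comp (measurable_pi_lambda _ hm)
    have hind : iIndepFun (fun j w => (superposition S w (A j)).toReal) (baseLaw c ν) := by
      rw [iIndepFun_iff_charFun_pi fun j => (hm j).aemeasurable]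
      intro t
      simp_rw [hreal _ (hA _).1 (hA _).2.2, charFun_map_cast_poissonMeasure]
      rw [charFun_apply, integral_map hm'.aemeasurable
        (Measurable.aestronglyMeasurable (by fun_prop)), ← Complex.exp_sum]
      have h := integral_cexp_superposition hS hd hU hc
        (fun j => (hA j).1) (fun j => (hA j).2.2.ne) hAd (fun j => t j)
      simpa [PiLp.inner_apply, ENNReal.coe_toNNReal_eq_toReal] using h
    have h2 := hind.comp (fun _ => ENNReal.ofReal) (fun _ => ENNReal.measurable_ofReal)
    have h3 : iIndepFun (fun j => (count (A j) : PoissonSpace μ → ℝ≥0∞) ∘ Φ) (baseLaw c ν) := by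
      refine h2.congr fun j => ?_
      filter_upwards [hae (A j) (hA j).1 (hA j).2.2] with w hw
      exact ENNReal.ofReal_toReal hw.ne
    rw [iIndepFun_iff_measure_inter_preimage_eq_mul] at h3 ⊢
    intro s B hB
    have hcm : ∀ j, Measurable (count (A j) : PoissonSpace μ → ℝ≥0∞) := fun j =>
      measurable_count (hA j).1 (hA j).2.1 (hA j).2.2
    rw [Measure.map_apply hΦ (Finset.measurableSet_biInter _ fun j hj => hcm j (hB j hj))]
    simp_rw [Set.preimage_iInter]
    refine (h3 s hB).trans (Finset.prod_congr rfl fun j hj => ?_)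
    rw [Measure.map_apply hΦ (hcm j (hB j hj))]
    rfl

/-- The law `μ*` of the Poisson point process with intensity `μ`, a probability measure on `X*`. -/
noncomputable def poissonLaw (μ : Measure X) [SigmaFinite μ] : Measure (PoissonSpace μ) :=
  (exists_isPoissonLaw μ).choose

lemma isPoissonLaw_poissonLaw (μ : Measure X) [SigmaFinite μ] : IsPoissonLaw μ (poissonLaw μ) :=
  (exists_isPoissonLaw μ).choose_spec

end Existence

section Suspension

variable {X : Type*} [MeasurableSpace X]

lemma isPurelyAtomic_map {ω : Measure X} (h : IsPurelyAtomic ω) (S : X ≃ᵐ X) :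
    IsPurelyAtomic (ω.map S) := by
  intro A hA h0
  rw [S.map_apply] at h0
  obtain ⟨x, hx, hx0⟩ := h _ (S.measurable hA) h0
  refine ⟨S x, hx, fun h1 => hx0 ?_⟩
  rw [S.map_apply] at h1
  exact measure_mono_null (by simp) h1

/-- The transformation `S* : ω ↦ ω ∘ S⁻¹` of `X*`. -/
noncomputable def suspend {μ : Measure X} (S : X ≃ᵐ X) (ω : PoissonSpace μ) : PoissonSpace μ :=
  ⟨ω.1.map S, isPurelyAtomic_map ω.2.1 S, by
    have := ω.2.2
    exact S.sigmaFinite_map⟩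

/-- The Poisson suspension: `G` acts on `X*` by `g • ω = ω ∘ T_g⁻¹`, where `T_g x = g • x`. -/
noncomputable instance {G : Type*} [Group G] [MulAction G X] [MeasurableConstSMul G X]
    (μ : Measure X) : MulAction G (PoissonSpace μ) where
  smul g ω := suspend (MeasurableEquiv.smul g) ω
  one_smul ω := by
    refine Subtype.ext ?_
    change ω.1.map (fun x => (1 : G) • x) = ω.1
    simp
  mul_smul g h ω := by
    refine Subtype.ext ?_
    change ω.1.map (fun x => (g * h) • x) = (ω.1.map (fun x => h • x)).map (fun x => g • x)
    rw [Measure.map_map (measurable_const_smul g) (measurable_const_smul h)]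
    simp only [mul_smul, Function.comp_def]

end Suspension

end PoissonSuspension

open PoissonSuspension

/-! Everything rests on the exponential formula (`exponential_formula`): if `exp w - 1` is
`μ`-integrable, then `E exp(∫ w dω) = exp(∫ (exp w - 1) dμ)`. It comes from the Poisson moment
generating function and independence for simple functions, then a limit.

Write `ν = μ ∘ S⁻¹` and `w = log(dν/dμ)`, so that `exp w - 1 = dν/dμ - 1`. The candidate density of
the image of `μ*` under `S*` is `ρ(ω) = exp(∫ w dω)`. The vanishing of `χ` gives it total mass one.
For a step function `f` the formula applied to `w + f` yields `E[ρ exp(∫ f dω)] = exp(∫ (exp f - 1)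
dν)`, which is the moment generating function of the counts under the image law. Finite-dimensional
moment generating functions determine the law (`ext_of_integral_exp_count`), so `ρ` is the density
(`map_suspend_eq_withDensity`) and each `T*_g` is nonsingular.

Applied to `-2w`, the same formula gives `E[ρ⁻²] = exp(∫ ((dμ/dν)² - 1) dμ)`. The summability
hypothesis therefore says that `∑ b_k^(1+ϑ) ρ_k⁻²` has finite expectation, hence is finite almost
surely. Its terms are eventually at most one, so eventually `b_k ≤ ρ_k^(2/(1+ϑ))`, and divergence of
`∑ b_k` passes to the series of powers of densities (`tsum_rpow_eq_top`).

When `ϑ ≤ 1` the exponent `2/(1+ϑ)` is at least one and `∑ ρ_k` itself diverges. If conservativity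
failed for some `A` and `K`, the sets `g_k⁻¹ A` would be pairwise disjoint modulo null sets for
large `k`. Their measures would have finite sum, but that sum is `∫_A ∑ ρ_k = ∞`
(`conservativeAlong_of_tsum_rnDeriv_eq_top`). -/

namespace PoissonSuspension

/-! ### Counts of arbitrary measurable sets and Campbell's formula -/

section Counts

variable {X : Type*} [MeasurableSpace X] {μ : Measure X} {P : Measure (PoissonSpace μ)}

lemma ae_count_eq_natCast (hP : IsPoissonLaw μ P) {A : Set X} (hA : MeasurableSet A)
    (h0 : 0 < μ A) (h1 : μ A < ∞) : ∀ᵐ ω ∂P, ∃ k : ℕ, count A ω = k := by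
  have h : ∀ᵐ x ∂(P.map (count A)), x ∈ Set.range (fun k : ℕ => (k : ℝ≥0∞)) := by
    rw [hP.map_count A hA h0 h1]
    exact (ae_map_iff (p := fun x => x ∈ Set.range (fun k : ℕ => (k : ℝ≥0∞)))
      (Measurable.of_discrete).aemeasurable (Set.countable_range _).measurableSet).2
      (ae_of_all _ fun k => ⟨k, rfl⟩)
  filter_upwards [ae_of_ae_map (measurable_count hA h0 h1).aemeasurable h] with ω ⟨k, hk⟩
  exact ⟨k, hk.symm⟩

lemma lintegral_count_of_pos (hP : IsPoissonLaw μ P) {A : Set X} (hA : MeasurableSet A)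
    (h0 : 0 < μ A) (h1 : μ A < ∞) : ∫⁻ ω, count A ω ∂P = μ A := by
  have h := lintegral_map (μ := P) measurable_id (measurable_count hA h0 h1)
  simp only [id] at h
  rw [← h, hP.map_count A hA h0 h1, lintegral_map (f := fun x => x) measurable_id
    Measurable.of_discrete, lintegral_natCast_poissonMeasure, ENNReal.coe_toNNReal h1.ne]

lemma exists_measure_pos_lt_top [SigmaFinite μ] (hμ : μ ≠ 0) :
    ∃ B : Set X, MeasurableSet B ∧ 0 < μ B ∧ μ B < ∞ := by
  by_contra! h
  refine hμ (Measure.measure_univ_eq_zero.1 ?_)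
  rw [← iUnion_spanningSets μ, measure_iUnion_null_iff]
  intro n
  by_contra hn
  exact absurd (h _ (measurableSet_spanningSets μ n) (pos_iff_ne_zero.2 hn))
    (not_le.2 (measure_spanningSets_lt_top μ n))

/-- The `σ`-algebra and the Poisson axioms involve only sets of positive finite measure, so null
sets need an argument. For such a set `B`, the counts of `B \ A` and `B ∪ A` are ordered and have
the same finite mean, hence agree almost surely; `A` is squeezed between them. This needs one such
`B`, whence `μ ≠ 0`. -/
lemma count_ae_eq_zero [SigmaFinite μ] (hμ : μ ≠ 0) (hP : IsPoissonLaw μ P) {A : Set X}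
    (hA : MeasurableSet A) (h0 : μ A = 0) : (count A : PoissonSpace μ → ℝ≥0∞) =ᵐ[P] 0 := by
  obtain ⟨B, hB, hB0, hB1⟩ := exists_measure_pos_lt_top hμ
  have hd : μ (B \ A) = μ B := measure_sdiff_null h0
  have hu : μ (B ∪ A) = μ B := 
    le_antisymm ((measure_union_le _ _).trans (by rw [h0, add_zero]))
      (measure_mono Set.subset_union_left)
  have hdm := measurable_count (hB.diff hA) (by rwa [hd]) (by rwa [hd])
  have hum := measurable_count (hB.union hA) (by rwa [hu]) (by rwa [hu])
  have hle : (count (B \ A) : PoissonSpace μ → ℝ≥0∞) ≤ᵐ[P] count (B ∪ A) :=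
    ae_of_all _ fun ω => measure_mono (Set.sdiff_subset.trans Set.subset_union_left)
  have heq := ae_eq_of_ae_le_of_lintegral_le hle
    (by rw [lintegral_count_of_pos hP (hB.diff hA) (by rwa [hd]) (by rwa [hd]), hd]; exact hB1.ne)
    hum.aemeasurable
    (by rw [lintegral_count_of_pos hP (hB.diff hA) (by rwa [hd]) (by rwa [hd]), hd,
      lintegral_count_of_pos hP (hB.union hA) (by rwa [hu]) (by rwa [hu]), hu])
  filter_upwards [heq, ae_count_eq_natCast hP (hB.diff hA) (by rwa [hd]) (by rwa [hd])]
    with ω hω ⟨k, hk⟩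
  have h2 : count (B ∪ A) ω = count (B \ A) ω + count A ω := by
    unfold count
    rw [← measure_union disjoint_sdiff_self_left hA, Set.sdiff_union_self]
  -- The count of `B \ A` is a natural number, hence finite, and can be cancelled.
  rw [h2, hk] at hω
  have : (k : ℝ≥0∞) + 0 = k + count A ω := by simpa using hω
  exact ((ENNReal.add_right_inj (ENNReal.natCast_ne_top k)).1 this).symm

lemma ae_count_eq_natCast_of_lt_top [SigmaFinite μ] (hμ : μ ≠ 0) (hP : IsPoissonLaw μ P)
    {A : Set X} (hA : MeasurableSet A) (h1 : μ A < ∞) : ∀ᵐ ω ∂P, ∃ k : ℕ, count A ω = k := by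
  rcases eq_or_ne (μ A) 0 with h0 | h0
  · filter_upwards [count_ae_eq_zero hμ hP hA h0] with ω hω
    exact ⟨0, by simpa using hω⟩
  · exact ae_count_eq_natCast hP hA (pos_iff_ne_zero.2 h0) h1

/-- Extends measurability to sets of infinite measure, as an increasing limit of counts of pieces of
finite measure. -/
lemma measurable_count_of_pos [SigmaFinite μ] {A : Set X} (hA : MeasurableSet A) (h0 : 0 < μ A) :
    Measurable (count A : PoissonSpace μ → ℝ≥0∞) := by
  have hu : A = ⋃ n, A ∩ spanningSets μ n := by
    rw [← Set.inter_iUnion, iUnion_spanningSets, Set.inter_univ]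
  have hmono : Monotone fun n => A ∩ spanningSets μ n := fun i j hij =>
    Set.inter_subset_inter_right _ (monotone_spanningSets μ hij)
  have hfin : ∀ n, μ (A ∩ spanningSets μ n) < ∞ := fun n =>
    (measure_mono Set.inter_subset_right).trans_lt (measure_spanningSets_lt_top μ n)
  -- The exhaustion must start at a piece of positive measure, since counts of null sets need not be
  -- measurable.
  obtain ⟨m, hm⟩ : ∃ m, 0 < μ (A ∩ spanningSets μ m) := by
    by_contra! h
    rw [hu] at h0
    exact h0.ne' (measure_iUnion_null fun n => le_antisymm (h n) zero_le)
  have h : (count A : PoissonSpace μ → ℝ≥0∞) =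
      fun ω => ⨆ n, count (A ∩ spanningSets μ (m + n)) ω := by
    ext ω
    have hu' : A = ⋃ n, A ∩ spanningSets μ (m + n) := by
      refine subset_antisymm (fun x hx => ?_) (Set.iUnion_subset fun n => Set.inter_subset_left)
      rw [hu] at hx
      obtain ⟨n, hn⟩ := Set.mem_iUnion.1 hx
      exact Set.mem_iUnion.2 ⟨n, hmono (Nat.le_add_left n m) hn⟩
    unfold count
    conv_lhs => rw [hu']
    exact (show Monotone fun n => A ∩ spanningSets μ (m + n) from fun i j hij =>
      hmono (Nat.add_le_add_left hij m)).measure_iUnion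
  rw [h]
  exact Measurable.iSup fun n => measurable_count (hA.inter (measurableSet_spanningSets μ _))
    (hm.trans_le (measure_mono (hmono (Nat.le_add_right m n)))) (hfin _)

lemma aemeasurable_count [SigmaFinite μ] (hμ : μ ≠ 0) (hP : IsPoissonLaw μ P) {A : Set X}
    (hA : MeasurableSet A) : AEMeasurable (count A : PoissonSpace μ → ℝ≥0∞) P := by
  rcases eq_or_ne (μ A) 0 with h0 | h0
  · exact aemeasurable_zero.congr (count_ae_eq_zero hμ hP hA h0).symm
  · exact (measurable_count_of_pos hA (pos_iff_ne_zero.2 h0)).aemeasurable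

lemma lintegral_count_of_lt_top [SigmaFinite μ] (hμ : μ ≠ 0) (hP : IsPoissonLaw μ P) {A : Set X}
    (hA : MeasurableSet A) (h1 : μ A < ∞) : ∫⁻ ω, count A ω ∂P = μ A := by
  rcases eq_or_ne (μ A) 0 with h0 | h0
  · rw [lintegral_congr_ae (count_ae_eq_zero hμ hP hA h0), h0]; simp
  · exact lintegral_count_of_pos hP hA (pos_iff_ne_zero.2 h0) h1

lemma lintegral_count [SigmaFinite μ] (hμ : μ ≠ 0) (hP : IsPoissonLaw μ P) {A : Set X}
    (hA : MeasurableSet A) : ∫⁻ ω, count A ω ∂P = μ A := by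
  have hu : A = ⋃ n, A ∩ spanningSets μ n := by
    rw [← Set.inter_iUnion, iUnion_spanningSets, Set.inter_univ]
  have hmono : Monotone fun n => A ∩ spanningSets μ n := fun i j hij =>
    Set.inter_subset_inter_right _ (monotone_spanningSets μ hij)
  have hm : ∀ n, MeasurableSet (A ∩ spanningSets μ n) := fun n =>
    hA.inter (measurableSet_spanningSets μ n)
  have h : ∀ ν : Measure X, ν A = ⨆ n, ν (A ∩ spanningSets μ n) := fun ν => by
    conv_lhs => rw [hu]
    exact hmono.measure_iUnion
  calc ∫⁻ ω, count A ω ∂P = ∫⁻ ω, ⨆ n, count (A ∩ spanningSets μ n) ω ∂P :=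
        lintegral_congr fun ω => h ω.1
    _ = ⨆ n, ∫⁻ ω, count (A ∩ spanningSets μ n) ω ∂P :=
        lintegral_iSup' (fun n => aemeasurable_count hμ hP (hm n))
          (ae_of_all _ fun ω i j hij => measure_mono (hmono hij))
    _ = μ A := by
        rw [h μ]
        exact iSup_congr fun n => lintegral_count_of_lt_top hμ hP (hm n)
          ((measure_mono Set.inter_subset_right).trans_lt (measure_spanningSets_lt_top μ n))

/-- Campbell's formula for nonnegative functions. -/
theorem lintegral_lintegral_poisson [SigmaFinite μ] (hμ : μ ≠ 0) (hP : IsPoissonLaw μ P)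
    {u : X → ℝ≥0∞} (hu : Measurable u) :
    AEMeasurable (fun ω : PoissonSpace μ => ∫⁻ x, u x ∂ω.1) P ∧
      ∫⁻ ω, ∫⁻ x, u x ∂ω.1 ∂P = ∫⁻ x, u x ∂μ := by
  refine Measurable.ennreal_induction
    (motive := fun u => AEMeasurable (fun ω : PoissonSpace μ => ∫⁻ x, u x ∂ω.1) P ∧
      ∫⁻ ω, ∫⁻ x, u x ∂ω.1 ∂P = ∫⁻ x, u x ∂μ) ?_ ?_ ?_ hu
  · intro c A hA
    have h : ∀ ν : Measure X, ∫⁻ x, A.indicator (fun _ => c) x ∂ν = c * ν A := fun ν =>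
      lintegral_indicator_const hA c
    simp_rw [h]
    have := aemeasurable_count hμ hP hA
    refine ⟨this.const_mul c, ?_⟩
    exact (lintegral_const_mul'' c this).trans (congrArg _ (lintegral_count hμ hP hA))
  · intro f g _ hf hg hfi hgi
    simp only [Pi.add_apply, lintegral_add_left hf]
    exact ⟨hfi.1.add hgi.1, by rw [lintegral_add_left' hfi.1, hfi.2, hgi.2]⟩
  · intro f hf hmono h
    simp_rw [lintegral_iSup hf hmono]
    refine ⟨AEMeasurable.iSup fun n => (h n).1, ?_⟩
    rw [lintegral_iSup' (fun n => (h n).1)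
      (ae_of_all _ fun ω i j hij => lintegral_mono (hmono hij))]
    exact iSup_congr fun n => (h n).2

end Counts

/-! ### The exponential formula -/

section ExponentialFormula

lemma integral_exp_mul_poissonMeasure (c : ℝ≥0) (t : ℝ) :
    ∫ k : ℕ, Real.exp (t * k) ∂(poissonMeasure c) = Real.exp (c * (Real.exp t - 1)) := by
  rw [integral_poissonMeasure]
  calc ∑' k : ℕ, (Real.exp (-c) * c ^ k / k.factorial) • Real.exp (t * k)
      = ∑' k : ℕ, Real.exp (-c) * ((c * Real.exp t) ^ k / k.factorial) := by
        congr with k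
        rw [mul_comm t, Real.exp_nat_mul, mul_pow, smul_eq_mul]
        ring
    _ = Real.exp (-c) * Real.exp (c * Real.exp t) := by
        rw [tsum_mul_left, (NormedSpace.expSeries_div_hasSum_exp ((c : ℝ) * Real.exp t)).tsum_eq,
          Real.exp_eq_exp_ℝ]
    _ = _ := by
        rw [← Real.exp_add]
        congr 1
        ring

variable {X : Type*} [MeasurableSpace X] {μ : Measure X} {P : Measure (PoissonSpace μ)}

lemma integral_exp_mul_count (hP : IsPoissonLaw μ P) {A : Set X} (hA : MeasurableSet A)
    (h0 : 0 < μ A) (h1 : μ A < ∞) (t : ℝ) :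
    ∫ ω, Real.exp (t * (count A ω).toReal) ∂P =
      Real.exp ((μ A).toReal * (Real.exp t - 1)) := by
  have hm : Measurable fun x : ℝ≥0∞ => Real.exp (t * x.toReal) := by fun_prop
  rw [← integral_map (f := fun x : ℝ≥0∞ => Real.exp (t * x.toReal))
    (measurable_count hA h0 h1).aemeasurable hm.aestronglyMeasurable, hP.map_count A hA h0 h1,
    integral_map Measurable.of_discrete.aemeasurable hm.aestronglyMeasurable]
  simp_rw [ENNReal.toReal_natCast]
  exact integral_exp_mul_poissonMeasure _ t

/-- Joint moment generating function of the counts of disjoint sets. -/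
lemma integral_exp_sum_mul_count [SigmaFinite μ] (hμ : μ ≠ 0) (hP : IsPoissonLaw μ P)
    {ι : Type*} [Fintype ι] {A : ι → Set X} (hA : ∀ j, MeasurableSet (A j))
    (hfin : ∀ j, μ (A j) < ∞) (hd : Pairwise fun i j => Disjoint (A i) (A j)) (t : ι → ℝ) :
    ∫ ω, Real.exp (∑ j, t j * (count (A j) ω).toReal) ∂P =
      Real.exp (∑ j, (μ (A j)).toReal * (Real.exp (t j) - 1)) := by
  classical
  -- Independence is available only for sets of positive measure; the other counts vanish almost
  -- surely and are dropped.
  let ι' := {j // μ (A j) ≠ 0}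
  have hind : iIndepFun (fun j : ι' => (count (A j) : PoissonSpace μ → ℝ≥0∞)) P := by
    let e := Fintype.equivFin ι'
    have h := hP.iIndepFun_count (Fintype.card ι') (fun i => A (e.symm i))
      (fun i => ⟨hA _, pos_iff_ne_zero.2 (e.symm i).2, hfin _⟩)
      (fun i j hij => hd fun h => hij (e.symm.injective (Subtype.ext h)))
    simpa [Function.comp_def] using h.precomp e.injective
  have hm : ∀ j : ι', Measurable (count (A j) : PoissonSpace μ → ℝ≥0∞) := fun j =>
    measurable_count (hA j) (pos_iff_ne_zero.2 j.2) (hfin j)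
  have hz : ∀ᵐ ω ∂P, ∀ j, μ (A j) = 0 → count (A j) ω = 0 := by
    rw [ae_all_iff]
    intro j
    by_cases h0 : μ (A j) = 0
    · filter_upwards [count_ae_eq_zero hμ hP (hA j) h0] with ω hω _ using hω
    · exact ae_of_all _ fun ω h => absurd h h0
  have hsub : ∀ f : ι → ℝ, (∀ j, μ (A j) = 0 → f j = 0) → ∑ j, f j = ∑ j : ι', f j := by
    intro f hf
    rw [← Finset.sum_filter_of_ne (p := fun j => μ (A j) ≠ 0) fun j _ h h0 => h (hf j h0)]
    exact Finset.sum_subtype _ (by simp) f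
  rw [hsub _ fun j hj => by simp [hj], Real.exp_sum]
  calc ∫ ω, Real.exp (∑ j, t j * (count (A j) ω).toReal) ∂P
      = ∫ ω, ∏ j : ι', Real.exp (t j * (count (A j) ω).toReal) ∂P := by
        refine integral_congr_ae ?_
        filter_upwards [hz] with ω hω
        rw [hsub _ fun j hj => by simp [hω j hj], Real.exp_sum]
    _ = ∏ j : ι', ∫ ω, Real.exp (t j * (count (A j) ω).toReal) ∂P :=
        hind.integral_fun_prod_comp (f := fun (j : ι') (x : ℝ≥0∞) => Real.exp (t j * x.toReal))
          (fun j => (hm j).aemeasurable)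
          (fun j => Measurable.aestronglyMeasurable (by fun_prop))
    _ = _ := Finset.prod_congr rfl fun j _ =>
        integral_exp_mul_count hP (hA j) (pos_iff_ne_zero.2 j.2) (hfin j) _

/-- The measure is left arbitrary because this serves both for `μ` and for a single configuration
`ω`. -/
lemma integral_comp_simpleFunc (s : SimpleFunc X ℝ) {ν : Measure X}
    (hs : ν (Function.support s) < ∞) {f : ℝ → ℝ} (hf : f 0 = 0) :
    ∫ x, f (s x) ∂ν = ∑ c : {c // c ∈ s.range.filter (· ≠ 0)},
      f c * (ν (s ⁻¹' {(c : ℝ)})).toReal := by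
  have hi : Integrable s ν := SimpleFunc.integrable_iff_finMeasSupp.2 hs
  have hi' : Integrable (s.map f) ν :=
    SimpleFunc.integrable_iff_finMeasSupp.2 (SimpleFunc.FinMeasSupp.map hs hf)
  have h := SimpleFunc.integral_eq_integral _ hi'
  rw [SimpleFunc.map_integral s f hi hf] at h
  calc ∫ x, f (s x) ∂ν = ∑ c ∈ s.range, ν.real (s ⁻¹' {c}) • f c := h.symm
    _ = ∑ c ∈ s.range.filter (· ≠ 0), ν.real (s ⁻¹' {c}) • f c := by
        refine (Finset.sum_filter_of_ne (p := (· ≠ 0)) fun c _ h h0 => h ?_).symm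
        rw [h0, hf, smul_zero]
    _ = _ := by
        rw [Finset.sum_subtype (s.range.filter (· ≠ 0)) (fun _ => Iff.rfl)]
        exact Finset.sum_congr rfl fun c _ => by rw [smul_eq_mul, mul_comm]; rfl

lemma integral_exp_integral_simpleFunc [SigmaFinite μ] (hμ : μ ≠ 0) (hP : IsPoissonLaw μ P)
    (s : SimpleFunc X ℝ) (hs : μ (Function.support s) < ∞) :
    ∫ ω : PoissonSpace μ, Real.exp (∫ x, s x ∂ω.1) ∂P =
      Real.exp (∫ x, (Real.exp (s x) - 1) ∂μ) := by
  have hsupp : MeasurableSet (Function.support s) := s.measurableSet_support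
  have hsub : ∀ c : {c // c ∈ s.range.filter (· ≠ 0)},
      s ⁻¹' {(c : ℝ)} ⊆ Function.support s := by
    rintro ⟨c, hc⟩ x (hx : s x = c)
    rw [Function.mem_support, hx]
    exact (Finset.mem_filter.1 hc).2
  rw [integral_comp_simpleFunc s hs (f := fun y => Real.exp y - 1) (by simp)]
  simp_rw [mul_comm (Real.exp _ - 1)]
  rw [← integral_exp_sum_mul_count hμ hP (A := fun c : {c // c ∈ s.range.filter (· ≠ 0)} =>
    s ⁻¹' {(c : ℝ)}) (fun c => s.measurableSet_preimage _)
    (fun c => (measure_mono (hsub c)).trans_lt hs)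
    (fun c d hcd => (Set.disjoint_singleton.2 fun h => hcd (Subtype.ext h)).preimage _)]
  refine integral_congr_ae ?_
  filter_upwards [ae_count_eq_natCast_of_lt_top hμ hP hsupp hs] with ω ⟨k, hk⟩
  have h : ω.1 (Function.support s) < ∞ := by
    change count (Function.support s) ω < ∞
    simp [hk]
  rw [integral_comp_simpleFunc s h (f := fun y => y) rfl]
  rfl

lemma abs_le_exp_abs_mul (x : ℝ) : |x| ≤ Real.exp |x| * |Real.exp x - 1| := by
  rcases le_total 0 x with h | h
  · have h1 := Real.add_one_le_exp x
    rw [abs_of_nonneg h, abs_of_nonneg (by linarith)]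
    nlinarith
  · have h1 := Real.add_one_le_exp (-x)
    have h2 : Real.exp x ≤ 1 := Real.exp_le_one_iff.2 h
    have h3 : Real.exp (-x) * Real.exp x = 1 := by rw [← Real.exp_add]; simp
    rw [abs_of_nonpos h, abs_of_nonpos (by linarith)]
    nlinarith

/-- An integrand `w` with `exp w - 1` integrable is integrable for almost every configuration. -/
theorem ae_integrable_poisson [SigmaFinite μ] (hμ : μ ≠ 0) (hP : IsPoissonLaw μ P)
    {w : X → ℝ} (hw : Measurable w) (hi : Integrable (fun x => Real.exp (w x) - 1) μ) :
    ∀ᵐ ω ∂P, Integrable w ω.1 := by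
  -- Where `|w| > 1` one has `|exp w - 1| ≥ 1/2`, so `B 0` has finite measure. The counts of the `B
  -- n` are then integers decreasing to zero, so one of them is zero and `w` is `ω`-a.e. bounded. On
  -- bounded values `|w|` is dominated by a multiple of `|exp w - 1|`, which is `ω`-integrable by
  -- Campbell's formula.
  let B : ℕ → Set X := fun n => {x | (n : ℝ) + 1 < |w x|}
  have hB : ∀ n, MeasurableSet (B n) := fun n => measurableSet_lt measurable_const hw.abs
  have hanti : Antitone B := fun i j hij x (hx : (j : ℝ) + 1 < |w x|) => by
    have : (i : ℝ) ≤ j := by exact_mod_cast hij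
    exact show (i : ℝ) + 1 < |w x| by linarith
  have hB0 : μ (B 0) < ∞ := by
    refine (measure_mono fun x (hx : ((0 : ℕ) : ℝ) + 1 < |w x|) => ?_).trans_lt
      (hi.measure_norm_ge_lt_top (ε := 1 / 2) (by norm_num))
    change 1 / 2 ≤ |Real.exp (w x) - 1|
    simp only [Nat.cast_zero, zero_add] at hx
    rcases lt_abs.1 hx with h | h
    · exact le_trans (by linarith [Real.add_one_le_exp (w x)]) (le_abs_self _)
    · have h1 := Real.add_one_le_exp (-w x)
      have h3 : Real.exp (-w x) * Real.exp (w x) = 1 := by rw [← Real.exp_add]; simp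
      refine le_trans ?_ (neg_le_abs _)
      nlinarith [Real.exp_pos (w x)]
  have hfin : ∀ n, μ (B n) < ∞ := fun n => (measure_mono (hanti (Nat.zero_le n))).trans_lt hB0
  have hcount : ∀ᵐ ω ∂P, ∀ n, ∃ k : ℕ, count (B n) ω = k := ae_all_iff.2 fun n =>
    ae_count_eq_natCast_of_lt_top hμ hP (hB n) (hfin n)
  have hq : Measurable fun x => ‖Real.exp (w x) - 1‖ₑ := by fun_prop
  have hC := lintegral_lintegral_poisson hμ hP hq
  filter_upwards [hcount, ae_lt_top' hC.1 (by rw [hC.2]; exact hi.2.ne)] with ω hω hωi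
  have hlim : Tendsto (fun n => ω.1 (B n)) atTop (𝓝 0) := by
    have hcap : ⋂ n, B n = ∅ := by
      rw [Set.eq_empty_iff_forall_notMem]
      intro x hx
      obtain ⟨n, hn⟩ := exists_nat_gt |w x|
      have : (n : ℝ) + 1 < |w x| := Set.mem_iInter.1 hx n
      linarith
    rw [← measure_empty (μ := ω.1), ← hcap]
    refine tendsto_measure_iInter_atTop (fun n => (hB n).nullMeasurableSet) hanti ⟨0, ?_⟩
    obtain ⟨k, hk⟩ := hω 0
    change count (B 0) ω ≠ ∞
    simp [hk]
  obtain ⟨n, hn⟩ := (hlim.eventually_lt_const (u := 1) (by simp)).exists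
  have hn0 : ω.1 (B n) = 0 := by
    obtain ⟨k, hk⟩ := hω n
    change count (B n) ω < 1 at hn
    change count (B n) ω = 0
    rw [hk] at hn ⊢
    have : k < 1 := by exact_mod_cast hn
    simp [Nat.lt_one_iff.1 this]
  have hint : Integrable (fun x => Real.exp (w x) - 1) ω.1 :=
    ⟨Measurable.aestronglyMeasurable (by fun_prop), hωi⟩
  refine Integrable.mono' (hint.norm.const_mul (Real.exp (n + 1))) hw.aestronglyMeasurable ?_
  have hnB : ∀ᵐ x ∂ω.1, x ∉ B n := measure_eq_zero_iff_ae_notMem.1 hn0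
  filter_upwards [hnB] with x hx
  have hx' : |w x| ≤ n + 1 := not_lt.1 hx
  exact (abs_le_exp_abs_mul (w x)).trans
    (mul_le_mul_of_nonneg_right (Real.exp_le_exp.2 hx') (abs_nonneg _))

lemma aemeasurable_integral_poisson [SigmaFinite μ] (hμ : μ ≠ 0) (hP : IsPoissonLaw μ P)
    {w : X → ℝ} (hw : Measurable w) (hi : ∀ᵐ ω ∂P, Integrable w ω.1) :
    AEMeasurable (fun ω : PoissonSpace μ => ∫ x, w x ∂ω.1) P := by
  have h1 := (lintegral_lintegral_poisson hμ hP hw.ennreal_ofReal).1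
  have h2 := (lintegral_lintegral_poisson hμ hP hw.neg.ennreal_ofReal).1
  refine (h1.ennreal_toReal.sub h2.ennreal_toReal).congr ?_
  filter_upwards [hi] with ω hω
  exact (integral_eq_lintegral_pos_part_sub_lintegral_neg_part hω).symm

/-- Approximate the positive and negative parts from below and cut off to sets of finite measure.
Lying between `0` and `w` makes both `|s|` and `|exp s - 1|` dominated by the same expressions in
`w`, as dominated convergence requires. -/
lemma exists_simpleFunc_between [SigmaFinite μ] {w : X → ℝ} (hw : Measurable w) :
    ∃ s : ℕ → SimpleFunc X ℝ, (∀ n, μ (Function.support (s n)) < ∞) ∧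
      (∀ x, Tendsto (fun n => s n x) atTop (𝓝 (w x))) ∧
      ∀ n x, (0 ≤ s n x ∧ s n x ≤ w x) ∨ (w x ≤ s n x ∧ s n x ≤ 0) := by
  let u : ℕ → SimpleFunc X ℝ := fun n =>
    (SimpleFunc.eapprox (fun x => ENNReal.ofReal (w x)) n).map ENNReal.toReal
  let v : ℕ → SimpleFunc X ℝ := fun n =>
    (SimpleFunc.eapprox (fun x => ENNReal.ofReal (-w x)) n).map ENNReal.toReal
  have key : ∀ f : X → ℝ, Measurable f → ∀ x,
      Tendsto (fun n => (SimpleFunc.eapprox (fun x => ENNReal.ofReal (f x)) n x).toReal) atTop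
        (𝓝 (max (f x) 0)) ∧
      ∀ n, (SimpleFunc.eapprox (fun x => ENNReal.ofReal (f x)) n x).toReal ≤ max (f x) 0 := by
    intro f hf x
    rw [← ENNReal.toReal_ofReal']
    refine ⟨(ENNReal.tendsto_toReal ENNReal.ofReal_ne_top).comp
      (SimpleFunc.tendsto_eapprox hf.ennreal_ofReal x), fun n => ?_⟩
    refine ENNReal.toReal_mono ENNReal.ofReal_ne_top ?_
    rw [← SimpleFunc.iSup_eapprox_apply hf.ennreal_ofReal x]
    exact le_iSup (fun n => SimpleFunc.eapprox (fun x => ENNReal.ofReal (f x)) n x) n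
  have hS := measurableSet_spanningSets μ
  refine ⟨fun n => (u n - v n).restrict (spanningSets μ n), fun n => ?_, fun x => ?_,
    fun n x => ?_⟩
  · refine (measure_mono fun x hx => ?_).trans_lt (measure_spanningSets_lt_top μ n)
    rw [Function.mem_support, SimpleFunc.restrict_apply _ (hS n)] at hx
    exact Set.mem_of_indicator_ne_zero hx
  · have h : Tendsto (fun n => u n x - v n x) atTop (𝓝 (max (w x) 0 - max (-w x) 0)) :=
      (key w hw x).1.sub (key _ hw.neg x).1
    have h2 : max (w x) 0 - max (-w x) 0 = w x := by
      rcases le_total 0 (w x) with h | h <;> simp [h]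
    rw [h2] at h
    refine h.congr' ?_
    filter_upwards [eventually_ge_atTop (spanningSetsIndex μ x)] with n hn
    rw [SimpleFunc.restrict_apply _ (hS n), Set.indicator_of_mem]
    · rfl
    · exact monotone_spanningSets μ hn (mem_spanningSetsIndex μ x)
  · have hu := (key w hw x).2 n
    have hv := (key _ hw.neg x).2 n
    have hu0 : 0 ≤ u n x := ENNReal.toReal_nonneg
    have hv0 : 0 ≤ v n x := ENNReal.toReal_nonneg
    change u n x ≤ _ at hu
    change v n x ≤ _ at hv
    rw [SimpleFunc.restrict_apply _ (hS n)]
    by_cases hx : x ∈ spanningSets μ n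
    · rw [Set.indicator_of_mem hx]
      change (0 ≤ u n x - v n x ∧ u n x - v n x ≤ w x) ∨ (w x ≤ u n x - v n x ∧ u n x - v n x ≤ 0)
      rcases le_total 0 (w x) with h | h
      · rw [max_eq_left h] at hu
        rw [Pi.neg_apply, max_eq_right (by linarith)] at hv
        left; constructor <;> linarith
      · rw [max_eq_right h] at hu
        rw [Pi.neg_apply, max_eq_left (by linarith)] at hv
        right; constructor <;> linarith
    · rw [Set.indicator_of_notMem hx]
      rcases le_total 0 (w x) with h | h <;> simp [h]

lemma abs_exp_sub_one_le_of_between {a b : ℝ} (h : (0 ≤ a ∧ a ≤ b) ∨ (b ≤ a ∧ a ≤ 0)) :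
    |Real.exp a - 1| ≤ |Real.exp b - 1| := by
  rcases h with ⟨h0, h1⟩ | ⟨h1, h0⟩
  · have h2 := Real.one_le_exp h0
    have h3 := Real.exp_le_exp.2 h1
    rw [abs_of_nonneg (by linarith), abs_of_nonneg (by linarith)]
    linarith
  · have h2 := Real.exp_le_one_iff.2 h0
    have h3 := Real.exp_le_exp.2 h1
    rw [abs_of_nonpos (by linarith), abs_of_nonpos (by linarith)]
    linarith

lemma abs_le_of_between {a b : ℝ} (h : (0 ≤ a ∧ a ≤ b) ∨ (b ≤ a ∧ a ≤ 0)) : |a| ≤ |b| := by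
  rcases h with ⟨h0, h1⟩ | ⟨h1, h0⟩
  · exact abs_le_abs_of_nonneg h0 h1
  · exact abs_le_abs_of_nonpos h0 h1

lemma tendsto_integral_exp_sub_one {w : X → ℝ}
    (hi : Integrable (fun x => Real.exp (w x) - 1) μ) {s : ℕ → SimpleFunc X ℝ}
    (hlim : ∀ x, Tendsto (fun n => s n x) atTop (𝓝 (w x)))
    (hb : ∀ n x, (0 ≤ s n x ∧ s n x ≤ w x) ∨ (w x ≤ s n x ∧ s n x ≤ 0)) :
    Tendsto (fun n => Real.exp (∫ x, (Real.exp (s n x) - 1) ∂μ)) atTop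
      (𝓝 (Real.exp (∫ x, (Real.exp (w x) - 1) ∂μ))) := by
  refine (Real.continuous_exp.tendsto _).comp ?_
  refine tendsto_integral_of_dominated_convergence (fun x => |Real.exp (w x) - 1|)
    (fun n => ?_) hi.abs (fun n => ae_of_all _ fun x => ?_) (ae_of_all _ fun x => ?_)
  · have := (s n).measurable
    exact Measurable.aestronglyMeasurable (by fun_prop)
  · exact abs_exp_sub_one_le_of_between (hb n x)
  · exact ((Real.continuous_exp.tendsto _).comp (hlim x)).sub_const 1

lemma tendsto_exp_integral {w : X → ℝ} {ν : Measure X} (hi : Integrable w ν)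
    {s : ℕ → SimpleFunc X ℝ} (hlim : ∀ x, Tendsto (fun n => s n x) atTop (𝓝 (w x)))
    (hb : ∀ n x, (0 ≤ s n x ∧ s n x ≤ w x) ∨ (w x ≤ s n x ∧ s n x ≤ 0)) :
    Tendsto (fun n => Real.exp (∫ x, s n x ∂ν)) atTop (𝓝 (Real.exp (∫ x, w x ∂ν))) :=
  (Real.continuous_exp.tendsto _).comp <|
    tendsto_integral_of_dominated_convergence (fun x => |w x|)
      (fun n => (s n).aestronglyMeasurable) hi.abs
      (fun n => ae_of_all _ fun x => abs_le_of_between (hb n x)) (ae_of_all _ hlim)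

/-- The integral of a non-integrable function is zero by convention, whereas here it equals a
positive exponential. -/
lemma integrable_exp_integral_simpleFunc [SigmaFinite μ] (hμ : μ ≠ 0) (hP : IsPoissonLaw μ P)
    (s : SimpleFunc X ℝ) (hs : μ (Function.support s) < ∞) :
    Integrable (fun ω : PoissonSpace μ => Real.exp (∫ x, s x ∂ω.1)) P := by
  by_contra h
  have h1 := integral_exp_integral_simpleFunc hμ hP s hs
  rw [integral_undef h] at h1
  exact (Real.exp_pos _).ne h1

/-- Fatou's lemma along the simple approximations; the bound it gives is the right side of the
exponential formula. -/
lemma integrable_exp_integral [SigmaFinite μ] (hμ : μ ≠ 0) (hP : IsPoissonLaw μ P)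
    {w : X → ℝ} (hw : Measurable w)
    (hi : Integrable (fun x => Real.exp (w x) - 1) μ) :
    Integrable (fun ω : PoissonSpace μ => Real.exp (∫ x, w x ∂ω.1)) P := by
  obtain ⟨s, hs, hlim, hb⟩ := exists_simpleFunc_between (μ := μ) hw
  have hae := ae_integrable_poisson hμ hP hw hi
  have hsi := fun n => integrable_exp_integral_simpleFunc hμ hP (s n) (hs n)
  refine ⟨(Real.measurable_exp.comp_aemeasurable
    (aemeasurable_integral_poisson hμ hP hw hae)).aestronglyMeasurable, ?_⟩
  have hF : ∫⁻ ω : PoissonSpace μ, ‖Real.exp (∫ x, w x ∂ω.1)‖ₑ ∂P ≤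
      liminf (fun n => ∫⁻ ω : PoissonSpace μ, ‖Real.exp (∫ x, s n x ∂ω.1)‖ₑ ∂P) atTop := by
    refine le_trans (lintegral_mono_ae ?_)
      (lintegral_liminf_le' fun n => (hsi n).aestronglyMeasurable.enorm)
    filter_upwards [hae] with ω hω
    exact (tendsto_exp_integral hω hlim hb).enorm.liminf_eq.ge
  refine lt_of_le_of_lt hF ?_
  have h : ∀ n, ∫⁻ ω : PoissonSpace μ, ‖Real.exp (∫ x, s n x ∂ω.1)‖ₑ ∂P =
      ENNReal.ofReal (Real.exp (∫ x, (Real.exp (s n x) - 1) ∂μ)) := by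
    intro n
    rw [← integral_exp_integral_simpleFunc hμ hP (s n) (hs n),
      ofReal_integral_eq_lintegral_ofReal (hsi n) (ae_of_all _ fun _ => (Real.exp_pos _).le)]
    exact lintegral_congr fun ω => Real.enorm_of_nonneg (Real.exp_pos _).le
  simp_rw [h]
  rw [(ENNReal.tendsto_ofReal (tendsto_integral_exp_sub_one hi hlim hb)).liminf_eq]
  exact ENNReal.ofReal_lt_top

/-- The exponential formula for the Poisson point process. -/
theorem exponential_formula [SigmaFinite μ] (hμ : μ ≠ 0) (hP : IsPoissonLaw μ P)
    {w : X → ℝ} (hw : Measurable w) (hi : Integrable (fun x => Real.exp (w x) - 1) μ) :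
    Integrable (fun ω : PoissonSpace μ => Real.exp (∫ x, w x ∂ω.1)) P ∧
      ∫ ω : PoissonSpace μ, Real.exp (∫ x, w x ∂ω.1) ∂P =
        Real.exp (∫ x, (Real.exp (w x) - 1) ∂μ) := by
  obtain ⟨s, hs, hlim, hb⟩ := exists_simpleFunc_between (μ := μ) hw
  have hae := ae_integrable_poisson hμ hP hw hi
  -- The dominating function for the limit is `exp(∫ w⁺ dω)`, because every approximation satisfies
  -- `s n ≤ w⁺`; its hypothesis holds since `exp(w⁺) - 1 = (exp w - 1)⁺`.
  have hi' : Integrable (fun x => Real.exp (max (w x) 0) - 1) μ := by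
    refine hi.pos_part.congr (ae_of_all _ fun x => ?_)
    rcases le_total 0 (w x) with h | h
    · simp [h]
    · simp [h]
  have hdom := integrable_exp_integral hμ hP (hw.max measurable_const) hi'
  have hsi := fun n => integrable_exp_integral_simpleFunc hμ hP (s n) (hs n)
  have hae' := ae_integrable_poisson hμ hP (hw.max measurable_const) hi'
  refine ⟨integrable_exp_integral hμ hP hw hi, ?_⟩
  · have hl := tendsto_integral_of_dominated_convergence
      (F := fun n (ω : PoissonSpace μ) => Real.exp (∫ x, s n x ∂ω.1))
      (f := fun ω : PoissonSpace μ => Real.exp (∫ x, w x ∂ω.1)) _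
      (fun n => (hsi n).aestronglyMeasurable) hdom
      (fun n => by
        filter_upwards [hae, hae'] with ω h h'
        rw [Real.norm_eq_abs, Real.abs_exp]
        refine Real.exp_le_exp.2 (integral_mono ?_ h' fun x => ?_)
        · exact h.abs.mono' (s n).aestronglyMeasurable
            (ae_of_all _ fun x => abs_le_of_between (hb n x))
        · rcases hb n x with hx | hx
          · exact hx.2.trans (le_max_left _ _)
          · exact hx.2.trans (le_max_right _ _))
      (hae.mono fun ω hω => tendsto_exp_integral hω hlim hb)
    simp_rw [fun n => integral_exp_integral_simpleFunc hμ hP (s n) (hs n)] at hl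
    exact tendsto_nhds_unique hl (tendsto_integral_exp_sub_one hi hlim hb)

end ExponentialFormula

/-! ### Laws of configurations are determined by moment generating functions -/

section Uniqueness

/-- Finite-dimensional laws are determined by an everywhere finite moment generating function. -/
lemma map_eq_of_integral_exp_eq {Ω : Type*} [MeasurableSpace Ω] {P Q : Measure Ω}
    [IsProbabilityMeasure P] [IsProbabilityMeasure Q] {ι : Type*} [Fintype ι]
    {V : Ω → ι → ℝ} (hV : Measurable V)
    (hi : ∀ t : ι → ℝ, Integrable (fun w => Real.exp (∑ j, t j * V w j)) P)
    (h : ∀ t : ι → ℝ, ∫ w, Real.exp (∑ j, t j * V w j) ∂P =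
      ∫ w, Real.exp (∑ j, t j * V w j) ∂Q) : P.map V = Q.map V := by
  classical
  have := Measure.isProbabilityMeasure_map (μ := P) hV.aemeasurable
  have := Measure.isProbabilityMeasure_map (μ := Q) hV.aemeasurable
  refine Measure.ext_of_charFunDual (funext fun L => ?_)
  let t : ι → ℝ := fun j => L (Pi.single j 1)
  let Y : Ω → ℝ := fun w => ∑ j, t j * V w j
  have hL : ∀ v : ι → ℝ, L v = ∑ j, t j * v j := by
    intro v
    conv_lhs => rw [pi_eq_sum_univ' v]
    rw [map_sum]
    exact Finset.sum_congr rfl fun j _ => by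
      rw [map_smul, smul_eq_mul, mul_comm]
  have hs : ∀ (r : ℝ) w, r * Y w = ∑ j, (r * t j) * V w j := fun r w => by
    simp only [Y, Finset.mul_sum, mul_assoc]
  have hset : integrableExpSet Y P = Set.univ := by
    refine Set.eq_univ_of_forall fun r => ?_
    simp only [integrableExpSet, Set.mem_ofPred_eq, hs]
    exact hi _
  have hmgf : mgf Y P = mgf Y Q := by
    ext r
    simp only [mgf, hs]
    exact h _
  -- Since the moment generating function of each linear combination is finite on all of `ℝ`, it
  -- extends analytically to `ℂ`; its value at `I` is the characteristic function.
  have hc := eqOn_complexMGF_of_mgf hmgf (x := Complex.I) (by simp [hset])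
  have hLm : ∀ R : Measure Ω, charFunDual (R.map V) L = complexMGF Y R Complex.I := by
    intro R
    rw [charFunDual_apply, integral_map hV.aemeasurable
      (Measurable.aestronglyMeasurable (by fun_prop))]
    simp only [complexMGF, hL, Y, mul_comm Complex.I]
  rw [hLm, hLm, hc]

variable {X : Type*} [MeasurableSpace X] {μ : Measure X} {P Q : Measure (PoissonSpace μ)}

/-- The `σ`-algebra is pulled back from a product by the family of all counts, and a measure on a
product is fixed by its finite marginals. -/
lemma ext_of_map_count [IsProbabilityMeasure P] [IsProbabilityMeasure Q]
    (h : ∀ J : Finset {A : Set X // MeasurableSet A ∧ 0 < μ A ∧ μ A < ∞},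
      P.map (fun ω (A : J) => count A.1.1 ω) = Q.map (fun ω (A : J) => count A.1.1 ω)) :
    P = Q := by
  let I := {A : Set X // MeasurableSet A ∧ 0 < μ A ∧ μ A < ∞}
  let Ψ : PoissonSpace μ → I → ℝ≥0∞ := fun ω A => count A.1 ω
  have hΨ : Measurable Ψ := measurable_pi_lambda _ fun A =>
    measurable_count A.2.1 A.2.2.1 A.2.2.2
  have hr : ∀ R : Measure (PoissonSpace μ), ∀ J : Finset I,
      (R.map Ψ).map J.restrict = R.map (fun ω (A : J) => count A.1.1 ω) := fun R J =>
    Measure.map_map (Finset.measurable_restrict J) hΨ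
  have hmap : P.map Ψ = Q.map Ψ := by
    have hfin : ∀ J : Finset I, IsFiniteMeasure (P.map (fun ω (A : J) => count A.1.1 ω)) :=
      fun J => inferInstance
    exact IsProjectiveLimit.unique (P := fun J => P.map (fun ω (A : J) => count A.1.1 ω))
      (fun J => hr P J) (fun J => (hr Q J).trans (h J).symm)
  have hle : (inferInstance : MeasurableSpace (PoissonSpace μ)) ≤
      MeasurableSpace.comap Ψ inferInstance := by
    refine iSup₂_le fun A hA => ?_
    have : (count A : PoissonSpace μ → ℝ≥0∞) = (fun f : I → ℝ≥0∞ => f ⟨A, hA⟩) ∘ Ψ := rfl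
    rw [this, ← MeasurableSpace.comap_comp]
    exact MeasurableSpace.comap_mono (measurable_pi_apply _).comap_le
  ext B hB
  obtain ⟨C, hC, rfl⟩ := hle B hB
  rw [← Measure.map_apply hΨ hC, hmap, Measure.map_apply hΨ hC]

/-- A law on the space of configurations is determined by the joint moment generating functions
of the counts. -/
lemma ext_of_integral_exp_count [IsProbabilityMeasure P] [IsProbabilityMeasure Q]
    (hP : ∀ A : Set X, MeasurableSet A → 0 < μ A → μ A < ∞ → ∀ᵐ ω ∂P, count A ω ≠ ∞)
    (hQ : ∀ A : Set X, MeasurableSet A → 0 < μ A → μ A < ∞ → ∀ᵐ ω ∂Q, count A ω ≠ ∞)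
    (h : ∀ (J : Finset {A : Set X // MeasurableSet A ∧ 0 < μ A ∧ μ A < ∞}) (t : J → ℝ),
      Integrable (fun ω => Real.exp (∑ A, t A * (count A.1.1 ω).toReal)) P ∧
      ∫ ω, Real.exp (∑ A, t A * (count A.1.1 ω).toReal) ∂P =
        ∫ ω, Real.exp (∑ A, t A * (count A.1.1 ω).toReal) ∂Q) : P = Q := by
  refine ext_of_map_count fun J => ?_
  have hm : ∀ A : J, Measurable (count A.1.1 : PoissonSpace μ → ℝ≥0∞) := fun A =>
    measurable_count A.1.2.1 A.1.2.2.1 A.1.2.2.2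
  have hV : Measurable fun ω (A : J) => (count A.1.1 ω : ℝ≥0∞).toReal :=
    measurable_pi_lambda _ fun A => (hm A).ennreal_toReal
  have hmap := map_eq_of_integral_exp_eq (P := P) (Q := Q) hV (fun t => (h J t).1)
    (fun t => (h J t).2)
  have hofReal : Measurable fun (v : J → ℝ) (A : J) => ENNReal.ofReal (v A) :=
    measurable_pi_lambda _ fun A => (measurable_pi_apply A).ennreal_ofReal
  have key : ∀ m : Measure (PoissonSpace μ),
      (∀ A : Set X, MeasurableSet A → 0 < μ A → μ A < ∞ → ∀ᵐ ω ∂m, count A ω ≠ ∞) →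
      m.map (fun ω (A : J) => count A.1.1 ω) =
        (m.map fun ω (A : J) => (count A.1.1 ω).toReal).map
          fun (v : J → ℝ) (A : J) => ENNReal.ofReal (v A) := by
    intro m hm'
    rw [Measure.map_map hofReal hV]
    refine Measure.map_congr ?_
    have hall : ∀ᵐ ω ∂m, ∀ A : J, count A.1.1 ω ≠ ∞ := ae_all_iff.2 fun A =>
      hm' A.1.1 A.1.2.1 A.1.2.2.1 A.1.2.2.2
    filter_upwards [hall] with ω hω
    exact funext fun A => (ENNReal.ofReal_toReal (hω A)).symm
  rw [key P hP, key Q hQ, hmap]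

end Uniqueness

/-! ### The density of the image of the Poisson law under a suspension -/

section Nonsingularity

variable {X : Type*} [MeasurableSpace X] {μ : Measure X} {P : Measure (PoissonSpace μ)}

/-- The count of `A` after the suspension is the count of `S⁻¹ A`, which has positive but possibly
infinite measure. -/
lemma measurable_suspend [SigmaFinite μ] {S : X ≃ᵐ X} (hS : μ ≪ μ.map S) :
    Measurable (suspend S : PoissonSpace μ → PoissonSpace μ) := by
  refine measurable_of_measurable_count fun A hA h0 _ => ?_
  have h : (fun ω : PoissonSpace μ => count A (suspend S ω)) = count (S ⁻¹' A) := by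
    ext ω
    exact S.map_apply A
  rw [h]
  refine measurable_count_of_pos (S.measurable hA) ?_
  rw [← S.map_apply]
  exact pos_iff_ne_zero.2 fun h => h0.ne' (hS h)

lemma measure_lt_top_of_integrable_rnDeriv_sub_one {ν : Measure X} [SigmaFinite μ] [SigmaFinite ν]
    (hν : ν ≪ μ) (hi : Integrable (fun x => (ν.rnDeriv μ x).toReal - 1) μ) {A : Set X}
    (h : μ A < ∞) : ν A < ∞ := by
  have : IsFiniteMeasure (μ.restrict A) := ⟨by simpa using h⟩
  have h1 : Integrable (fun x => (ν.rnDeriv μ x).toReal) (μ.restrict A) := by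
    exact ((hi.restrict (s := A)).add (integrable_const 1)).congr
      (ae_of_all _ fun x => sub_add_cancel _ _)
  rw [← Measure.setLIntegral_rnDeriv hν]
  refine lt_of_le_of_lt (lintegral_mono_ae ?_) h1.2
  filter_upwards [ae_restrict_of_ae (Measure.rnDeriv_lt_top ν μ)] with x hx
  rw [Real.enorm_of_nonneg ENNReal.toReal_nonneg, ENNReal.ofReal_toReal hx.ne]

lemma integrable_exp_sub_one_of_bound {ν : Measure X} {f : X → ℝ} (hf : Integrable f ν) {M : ℝ}
    (hM : ∀ x, |f x| ≤ M) : Integrable (fun x => Real.exp (f x) - 1) ν := by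
  refine Integrable.mono' (hf.abs.const_mul (Real.exp M))
    ((Real.continuous_exp.comp_aestronglyMeasurable hf.1).sub aestronglyMeasurable_const)
    (ae_of_all _ fun x => ?_)
  have h2 : |Real.exp (f x) - 1| ≤ Real.exp |f x| * |f x| := by
    rcases le_total 0 (f x) with h | h
    · have h1 := Real.add_one_le_exp (-f x)
      have h3 : Real.exp (-f x) * Real.exp (f x) = 1 := by rw [← Real.exp_add]; simp
      rw [abs_of_nonneg h, abs_of_nonneg (by linarith [Real.one_le_exp h])]
      nlinarith [Real.exp_pos (f x)]
    · have h1 := Real.add_one_le_exp (f x)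
      rw [abs_of_nonpos h, abs_of_nonpos (by linarith [Real.exp_le_one_iff.2 h])]
      nlinarith [Real.one_le_exp (x := -f x) (by linarith)]
  exact h2.trans (mul_le_mul_of_nonneg_right (Real.exp_le_exp.2 (hM x)) (abs_nonneg _))

/-- The density of the image of the Poisson law under the suspension of a transformation. -/
noncomputable def suspensionDensity (μ : Measure X) (S : X ≃ᵐ X) (ω : PoissonSpace μ) : ℝ :=
  Real.exp (∫ x, Real.log ((μ.map S).rnDeriv μ x).toReal ∂ω.1)

lemma exp_log_rnDeriv_ae_eq {ν : Measure X} [SigmaFinite μ] [SigmaFinite ν] (hμν : μ ≪ ν) :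
    ∀ᵐ x ∂μ, Real.exp (Real.log (ν.rnDeriv μ x).toReal) = (ν.rnDeriv μ x).toReal := by
  filter_upwards [Measure.rnDeriv_pos' hμν, Measure.rnDeriv_lt_top ν μ] with x h1 h2
  exact Real.exp_log (ENNReal.toReal_pos h1.ne' h2.ne)

/-- The suspension of `S` transforms the Poisson law into an equivalent measure with an explicit
density. -/
theorem map_suspend_eq_withDensity [SigmaFinite μ] (hμ : μ ≠ 0) (hP : IsPoissonLaw μ P)
    {S : X ≃ᵐ X} (h1 : μ.map S ≪ μ) (h2 : μ ≪ μ.map S)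
    (hi : Integrable (fun x => ((μ.map S).rnDeriv μ x).toReal - 1) μ)
    (h0 : ∫ x, (((μ.map S).rnDeriv μ x).toReal - 1) ∂μ = 0) :
    P.map (suspend S) = P.withDensity fun ω => ENNReal.ofReal (suspensionDensity μ S ω) := by
  have := hP.isProbabilityMeasure
  have hσ : SigmaFinite (μ.map S) := S.sigmaFinite_map
  set ν := μ.map S with hν
  let w : X → ℝ := fun x => Real.log (ν.rnDeriv μ x).toReal
  have hw : Measurable w := (Measure.measurable_rnDeriv ν μ).ennreal_toReal.log
  have hew : ∀ᵐ x ∂μ, Real.exp (w x) = (ν.rnDeriv μ x).toReal := exp_log_rnDeriv_ae_eq h2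
  have hwi : Integrable (fun x => Real.exp (w x) - 1) μ :=
    hi.congr (hew.mono fun x hx => by simp only [hx])
  have hw0 : ∫ x, (Real.exp (w x) - 1) ∂μ = 0 := by
    rw [← h0]
    exact integral_congr_ae (hew.mono fun x hx => by simp only [hx])
  obtain ⟨hEi, hE⟩ := exponential_formula hμ hP hw hwi
  have hρ : ∀ ω : PoissonSpace μ, suspensionDensity μ S ω = Real.exp (∫ x, w x ∂ω.1) :=
    fun ω => rfl
  simp_rw [hρ]
  set ρ : PoissonSpace μ → ℝ≥0∞ := fun ω => ENNReal.ofReal (Real.exp (∫ x, w x ∂ω.1)) with hρdef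
  have hρm : AEMeasurable ρ P := hEi.1.aemeasurable.ennreal_ofReal
  have hmS := measurable_suspend (μ := μ) (S := S) h2
  have : IsProbabilityMeasure (P.map (suspend S)) :=
    Measure.isProbabilityMeasure_map hmS.aemeasurable
  -- The total mass is `exp(∫ (exp w - 1) dμ) = exp 0`.
  have : IsProbabilityMeasure (P.withDensity ρ) := by
    refine ⟨?_⟩
    rw [withDensity_apply _ MeasurableSet.univ, Measure.restrict_univ, hρdef,
      ← ofReal_integral_eq_lintegral_ofReal hEi (ae_of_all _ fun _ => (Real.exp_pos _).le),
      hE, hw0]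
    simp
  have hνfin : ∀ A : Set X, μ A < ∞ → ν A < ∞ := fun A hA =>
    measure_lt_top_of_integrable_rnDeriv_sub_one h1 hi hA
  have hfin : ∀ A : Set X, MeasurableSet A → μ A < ∞ → ∀ᵐ ω ∂P, count A ω ≠ ∞ := by
    intro A hA hA1
    filter_upwards [ae_count_eq_natCast_of_lt_top hμ hP hA hA1] with ω ⟨k, hk⟩
    simp [hk]
  have hfinS : ∀ A : Set X, MeasurableSet A → μ A < ∞ → ∀ᵐ ω ∂P, count (S ⁻¹' A) ω ≠ ∞ :=
    fun A hA hA1 => hfin _ (S.measurable hA) (by rw [← S.map_apply]; exact hνfin A hA1)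
  have hcS : ∀ (A : Set X) (ω : PoissonSpace μ), count A (suspend S ω) = count (S ⁻¹' A) ω :=
    fun A ω => S.map_apply A
  symm
  refine ext_of_integral_exp_count
    (fun A hA _ hA1 => (withDensity_absolutelyContinuous P ρ).ae_le (hfin A hA hA1))
    (fun A hA hA0 hA1 => ?_) fun J t => ?_
  · refine (ae_map_iff (p := fun ω : PoissonSpace μ => count A ω ≠ ∞) hmS.aemeasurable
      ((measurable_count hA hA0 hA1) (measurableSet_singleton ∞).compl)).2 ?_
    simp_rw [hcS]
    exact hfinS A hA hA1
  -- The sets in `J` may overlap, so the linear combination of counts is written as `∫ f dω` and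
  -- treated by the exponential formula instead of independence.
  let f : X → ℝ := fun x => ∑ A : J, A.1.1.indicator (fun _ => t A) x
  have hfm : Measurable f := Finset.measurable_fun_sum _ fun A _ =>
    measurable_const.indicator A.1.2.1
  have hfb : ∀ x, |f x| ≤ ∑ A : J, |t A| := fun x =>
    (Finset.abs_sum_le_sum_abs _ _).trans (Finset.sum_le_sum fun A _ => by
      by_cases hx : x ∈ A.1.1 <;> simp [hx])
  have hint : ∀ m : Measure X, (∀ A : J, m A.1.1 < ∞) →
      Integrable f m ∧ ∫ x, f x ∂m = ∑ A : J, t A * (m A.1.1).toReal := by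
    intro m hm
    have hA : ∀ A : J, Integrable (A.1.1.indicator fun _ => t A) m := fun A =>
      (integrable_indicator_iff A.1.2.1).2 (integrableOn_const (hm A).ne)
    refine ⟨integrable_finsetSum _ fun A _ => hA A, ?_⟩
    rw [integral_finsetSum _ fun A _ => hA A]
    refine Finset.sum_congr rfl fun A _ => ?_
    rw [integral_indicator_const _ A.1.2.1, smul_eq_mul, mul_comm]
    rfl
  have hfν : Integrable f ν := (hint ν fun A => hνfin _ A.1.2.2.2).1
  have hefν : Integrable (fun x => Real.exp (f x) - 1) ν := integrable_exp_sub_one_of_bound hfν hfb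
  have hall : ∀ᵐ ω ∂P, ∀ A : J, count A.1.1 ω ≠ ∞ := ae_all_iff.2 fun A =>
    hfin A.1.1 A.1.2.1 A.1.2.2.2
  have hallS : ∀ᵐ ω ∂P, ∀ A : J, count (S ⁻¹' A.1.1) ω ≠ ∞ := ae_all_iff.2 fun A =>
    hfinS A.1.1 A.1.2.1 A.1.2.2.2
  -- the moment generating function under the image
  have hright : ∫ ω, Real.exp (∑ A, t A * (count A.1.1 ω).toReal) ∂(P.map (suspend S)) =
      Real.exp (∫ x, (Real.exp (f x) - 1) ∂ν) := by
    rw [integral_map hmS.aemeasurable]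
    · have hfS : Integrable (fun x => Real.exp (f (S x)) - 1) μ :=
        (integrable_map_equiv S _).1 hefν
      rw [hν, integral_map_equiv]
      refine Eq.trans ?_ (exponential_formula hμ hP (hfm.comp S.measurable) hfS).2
      refine integral_congr_ae ?_
      filter_upwards [hallS] with ω hω
      have h := (hint (ω.1.map S) fun A => by
        rw [S.map_apply]; exact (hω A).lt_top).2
      rw [integral_map_equiv] at h
      exact congrArg Real.exp h.symm
    · refine (Real.measurable_exp.comp ?_).aestronglyMeasurable
      exact Finset.measurable_fun_sum _ fun A _ =>
        ((measurable_count A.1.2.1 A.1.2.2.1 A.1.2.2.2).ennreal_toReal).const_mul _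
  -- the moment generating function with respect to the density
  have hsmul : Integrable (fun x => (ν.rnDeriv μ x).toReal • (Real.exp (f x) - 1)) μ :=
    (integrable_rnDeriv_smul_iff h1).2 hefν
  -- The first summand integrates to `∫ (exp f - 1) dν` by change of measure, the second to zero.
  have hae : (fun x => (ν.rnDeriv μ x).toReal • (Real.exp (f x) - 1) +
      (Real.exp (w x) - 1)) =ᵐ[μ] fun x => Real.exp (w x + f x) - 1 := by
    filter_upwards [hew] with x hx
    rw [Real.exp_add, ← hx, smul_eq_mul]
    ring
  have hsum := (hsmul.add hwi).congr hae
  obtain ⟨hFi, hF⟩ := exponential_formula hμ hP (hw.add hfm) hsum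
  have hmul : (fun ω : PoissonSpace μ => (ρ ω).toReal •
      Real.exp (∑ A, t A * (count A.1.1 ω).toReal)) =ᵐ[P]
      fun ω => Real.exp (∫ x, (w + f) x ∂ω.1) := by
    filter_upwards [hall, ae_integrable_poisson hμ hP hw hwi] with ω hω hωw
    have h := hint ω.1 fun A => (hω A).lt_top
    simp only [Pi.add_apply]
    rw [integral_add hωw h.1, Real.exp_add, h.2, hρdef,
      ENNReal.toReal_ofReal (Real.exp_pos _).le, smul_eq_mul]
    rfl
  have hlt : ∀ᵐ ω ∂P, ρ ω < ∞ := ae_of_all _ fun _ => ENNReal.ofReal_lt_top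
  refine ⟨?_, ?_⟩
  · rw [integrable_withDensity_iff_integrable_smul₀' hρm hlt]
    exact hFi.congr hmul.symm
  · rw [integral_withDensity_eq_integral_toReal_smul₀ hρm hlt, integral_congr_ae hmul, hF, hright]
    congr 1
    simp only [Pi.add_apply]
    rw [← integral_congr_ae hae, integral_add hsmul hwi, hw0, add_zero, integral_rnDeriv_smul h1]

end Nonsingularity

/-! ### Divergence of series -/

section Series

lemma tsum_nat_add_eq_top {f : ℕ → ℝ≥0∞} (hf : ∀ k, f k ≠ ∞) (h : ∑' k, f k = ∞) (n : ℕ) :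
    ∑' k, f (k + n) = ∞ := by
  by_contra hn
  rw [← ENNReal.summable.sum_add_tsum_nat_add' (k := n)] at h
  exact ENNReal.add_ne_top.2 ⟨ENNReal.sum_ne_top.2 fun k _ => hf k, hn⟩ h

/-- If the series converged, its terms would eventually be at most one, and then `f k ^ p ≤ f k`. -/
lemma tsum_eq_top_of_tsum_rpow_eq_top {f : ℕ → ℝ≥0∞} {p : ℝ} (hp : 1 ≤ p)
    (h : ∑' k, f k ^ p = ∞) : ∑' k, f k = ∞ := by
  by_contra hn
  have hlim := ENNReal.tendsto_atTop_zero_of_tsum_ne_top hn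
  obtain ⟨n, hn1⟩ := eventually_atTop.1 (hlim.eventually_le_const (u := 1) (by simp))
  have htail := tsum_nat_add_eq_top
    (fun k => ENNReal.rpow_ne_top_of_nonneg (by linarith) (ENNReal.ne_top_of_tsum_ne_top hn k)) h n
  refine ((ENNReal.tsum_le_tsum fun k => ?_).trans
    (ENNReal.tsum_comp_le_tsum_of_injective (add_left_injective n) f)).trans_lt
    (lt_top_iff_ne_top.2 hn) |>.ne htail
  simpa using ENNReal.rpow_le_rpow_of_exponent_ge (hn1 (k + n) (Nat.le_add_left n k)) hp

/-- Convergence in `h` forces `b k ^ (1 + ϑ) ≤ r k ^ 2` eventually; taking roots, `b k ≤ r k ^ (2 /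
(1 + ϑ))`. -/
lemma tsum_rpow_eq_top {ϑ : ℝ} (hϑ : 0 < ϑ) {b r : ℕ → ℝ} (hb0 : ∀ k, 0 < b k)
    (hr : ∀ k, 0 < r k) (hb : ∑' k, ENNReal.ofReal (b k) = ∞)
    (h : ∑' k, ENNReal.ofReal (b k ^ (1 + ϑ) * (r k ^ 2)⁻¹) ≠ ∞) :
    ∑' k, ENNReal.ofReal (r k) ^ (2 / (1 + ϑ)) = ∞ := by
  by_contra hn
  have hϑ' : 0 < 1 + ϑ := by linarith
  have hlim := ENNReal.tendsto_atTop_zero_of_tsum_ne_top h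
  have hs : Summable fun k => r k ^ (2 / (1 + ϑ)) := by
    refine (ENNReal.summable_toReal hn).congr fun k => ?_
    rw [← ENNReal.toReal_rpow, ENNReal.toReal_ofReal (hr k).le]
  have hbs : Summable b := by
    refine hs.of_norm_bounded_eventually_nat ?_
    filter_upwards [hlim.eventually_le_const (u := 1) (by simp)] with k hk
    have h1 : b k ^ (1 + ϑ) ≤ r k ^ 2 := by
      rw [ENNReal.ofReal_le_one, ← div_eq_mul_inv, div_le_one (pow_pos (hr k) 2)] at hk
      exact hk
    rw [Real.norm_of_nonneg (hb0 k).le]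
    calc b k = (b k ^ (1 + ϑ)) ^ (1 + ϑ)⁻¹ := by
          rw [← Real.rpow_mul (hb0 k).le, mul_inv_cancel₀ hϑ'.ne', Real.rpow_one]
      _ ≤ (r k ^ 2) ^ (1 + ϑ)⁻¹ :=
          Real.rpow_le_rpow (Real.rpow_nonneg (hb0 k).le _) h1 (inv_nonneg.2 hϑ'.le)
      _ = r k ^ (2 / (1 + ϑ)) := by
          rw [← Real.rpow_natCast, ← Real.rpow_mul (hr k).le, div_eq_mul_inv, Nat.cast_ofNat]
  exact hbs.tsum_ofReal_ne_top hb

end Series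

/-! ### From divergent derivatives to conservativity -/

section Conservativity

/-- Divergence of the sum of the Radon-Nikodym derivatives along a dispersed sequence implies
conservativity along the set of its quotients. -/
theorem conservativeAlong_of_tsum_rnDeriv_eq_top {G Z : Type*} [Group G] [TopologicalSpace G]
    [MeasurableSpace Z] [MulAction G Z] {ν : Measure Z} [IsFiniteMeasure ν]
    (hq : ∀ h : G, Measure.QuasiMeasurePreserving (fun z : Z => h • z) ν ν)
    {g : ℕ → G} (hg : IsDispersed g)
    (hs : ∀ᵐ z ∂ν, ∑' k, (ν.map fun z' => g k • z').rnDeriv ν z = ∞) :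
    ConservativeAlong ν {h : G | ∃ l m : ℕ, l > m ∧ h = g l * (g m)⁻¹} := by
  intro A hA hA0 K hK
  by_contra! hcon
  obtain ⟨N, hN⟩ := hg K hK
  -- The shift is `N + 1` because dispersion requires indices strictly above `N`.
  let B : ℕ → Set Z := fun k => (fun z => g (k + (N + 1)) • z) ⁻¹' A
  have hB : ∀ k, MeasurableSet (B k) := fun k => (hq _).measurable hA
  have hdisj : ∀ m l, m < l → ν (B m ∩ B l) = 0 := by
    intro m l hml
    have hml' : l + (N + 1) > m + (N + 1) := by omega
    have hnull := hcon (g (l + (N + 1)) * (g (m + (N + 1)))⁻¹)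
      ⟨⟨_, _, hml', rfl⟩, hN _ _ hml' (by omega)⟩
    -- With `h = g_l g_m⁻¹`, a point `z` of both sets has `g_l z = h (g_m z)` in `hA ∩ A`, which is
    -- null by assumption; quasi-invariance makes its preimage under `g_l` null.
    refine measure_mono_null ?_ ((hq (g (l + (N + 1)))).preimage_null (le_antisymm hnull zero_le))
    rintro z ⟨hm, hl⟩
    exact ⟨⟨g (m + (N + 1)) • z, hm, by simp [mul_smul]⟩, hl⟩
  have hpair : Pairwise (Function.onFun (AEDisjoint ν) B) := by
    intro m l hml
    rcases lt_or_gt_of_ne hml with h | h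
    · exact hdisj m l h
    · exact (Set.inter_comm _ _ ▸ hdisj l m h : ν (B m ∩ B l) = 0)
  have hsum : ∑' k, ν (B k) ≠ ∞ := by
    rw [← measure_iUnion₀ hpair fun k => (hB k).nullMeasurableSet]
    exact measure_ne_top _ _
  have hrn : ∀ k, ν (B k) = ∫⁻ z in A, (ν.map fun z' => g (k + (N + 1)) • z').rnDeriv ν z ∂ν := by
    intro k
    rw [Measure.setLIntegral_rnDeriv (hq _).absolutelyContinuous,
      Measure.map_apply (hq _).measurable hA]
  simp_rw [hrn] at hsum
  rw [← lintegral_tsum fun k => (Measure.measurable_rnDeriv _ _).aemeasurable] at hsum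
  have hfin : ∀ᵐ z ∂ν, ∀ k, (ν.map fun z' => g k • z').rnDeriv ν z ≠ ∞ :=
    ae_all_iff.2 fun k => Measure.rnDeriv_ne_top _ _
  refine hsum ?_
  have htop : ∀ᵐ z ∂(ν.restrict A),
      ∑' k, (ν.map fun z' => g (k + (N + 1)) • z').rnDeriv ν z = ∞ := by
    refine ae_restrict_of_ae ?_
    filter_upwards [hs, hfin] with z h1 h2 using tsum_nat_add_eq_top h2 h1 (N + 1)
  rw [lintegral_congr_ae htop, lintegral_const, Measure.restrict_apply_univ,
    ENNReal.top_mul hA0.ne']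

end Conservativity

/-! ### The trivial intensity and the inverse second moment of the density -/

section Suspension

variable {X : Type*} [MeasurableSpace X] {μ : Measure X} {P : Measure (PoissonSpace μ)}

/-- For `μ = 0` no set generates the `σ`-algebra, so only the empty set and the whole space are
measurable. -/
lemma map_eq_self_of_eq_zero [IsProbabilityMeasure P] (hμ : μ = 0)
    {f : PoissonSpace μ → PoissonSpace μ} (hf : Measurable f) : P.map f = P := by
  have hbot : (inferInstance : MeasurableSpace (PoissonSpace μ)) = ⊥ := by
    refine le_bot_iff.1 (iSup₂_le fun A hA => ?_)
    exact absurd hA.2.1 (by simp [hμ])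
  ext B hB
  rw [Measure.map_apply hf hB]
  have hB' : MeasurableSet[⊥] B := hbot ▸ hB
  rcases MeasurableSpace.measurableSet_bot_iff.1 hB' with rfl | rfl <;> simp

lemma absolutelyContinuous_map_of_mem_Aut {S : X ≃ᵐ X} (hS : S ∈ Aut μ) : μ ≪ μ.map S := by
  have h := hS.2.absolutelyContinuous.map S.measurable
  rwa [Measure.map_map S.measurable S.symm.measurable, S.self_comp_symm, Measure.map_id] at h

/-- The exponential formula with exponent `-2 log(dν/dμ)`, whose exponential is `(dμ/dν)²` because
the two derivatives are mutually inverse `μ`-a.e. -/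
lemma lintegral_inv_sq_suspensionDensity [SigmaFinite μ] (hμ : μ ≠ 0) (hP : IsPoissonLaw μ P)
    {S : X ≃ᵐ X} (h : μ ≪ μ.map S)
    (hi : Integrable (fun x => (μ.rnDeriv (μ.map S) x).toReal ^ 2 - 1) μ) :
    AEMeasurable (fun ω => ENNReal.ofReal ((suspensionDensity μ S ω ^ 2)⁻¹)) P ∧
    ∫⁻ ω, ENNReal.ofReal ((suspensionDensity μ S ω ^ 2)⁻¹) ∂P =
      ENNReal.ofReal (Real.exp (∫ x, ((μ.rnDeriv (μ.map S) x).toReal ^ 2 - 1) ∂μ)) := by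
  have hσ : SigmaFinite (μ.map S) := S.sigmaFinite_map
  set ν := μ.map S with hν
  let w : X → ℝ := fun x => -2 * Real.log (ν.rnDeriv μ x).toReal
  have hw : Measurable w := (Measure.measurable_rnDeriv ν μ).ennreal_toReal.log.const_mul _
  have hae : (fun x => (μ.rnDeriv ν x).toReal ^ 2 - 1) =ᵐ[μ] fun x => Real.exp (w x) - 1 := by
    filter_upwards [exp_log_rnDeriv_ae_eq h, Measure.inv_rnDeriv' h] with x h1 h2
    have h3 : w x = -(2 : ℕ) * Real.log (ν.rnDeriv μ x).toReal := by simp [w]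
    rw [h3, neg_mul, Real.exp_neg, Real.exp_nat_mul, h1, ← h2, Pi.inv_apply, ENNReal.toReal_inv,
      inv_pow]
  have hρ : ∀ ω : PoissonSpace μ,
      (suspensionDensity μ S ω ^ 2)⁻¹ = Real.exp (∫ x, w x ∂ω.1) := by
    intro ω
    rw [suspensionDensity, integral_const_mul, ← Real.exp_nat_mul, ← Real.exp_neg]
    congr 1
    push_cast
    ring
  obtain ⟨h1, h2⟩ := exponential_formula hμ hP hw (hi.congr hae)
  simp_rw [hρ]
  refine ⟨h1.1.aemeasurable.ennreal_ofReal, ?_⟩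
  rw [← ofReal_integral_eq_lintegral_ofReal h1 (ae_of_all _ fun _ => (Real.exp_pos _).le), h2,
    integral_congr_ae hae]

end Suspension

/-! ### The suspended action -/

section Action

variable {G X : Type*} [Group G] [MeasurableSpace X] [MulAction G X] [MeasurableConstSMul G X]
  {μ : Measure X} {P : Measure (PoissonSpace μ)}

/-- The density of the image under `h` involves `μ ∘ T_h⁻¹`, so the hypotheses on `Aut1` and `chi`
are used at `h⁻¹`. -/
lemma compMeasure_smul_inv (h : G) :
    compMeasure μ (MeasurableEquiv.smul h⁻¹ : X ≃ᵐ X) = μ.map (MeasurableEquiv.smul h : X ≃ᵐ X) := by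
  change μ.map (fun x => h⁻¹⁻¹ • x) = μ.map (fun x => h • x)
  rw [inv_inv]

lemma map_smul_eq_withDensity [SigmaFinite μ] (hμ : μ ≠ 0) (hP : IsPoissonLaw μ P)
    (hT : ∀ g : G, (MeasurableEquiv.smul g : X ≃ᵐ X) ∈ Aut1 μ)
    (hχ : ∀ g : G, chi μ (MeasurableEquiv.smul g : X ≃ᵐ X) = 0) (h : G) :
    P.map (fun ω => h • ω) = P.withDensity fun ω =>
      ENNReal.ofReal (suspensionDensity μ (MeasurableEquiv.smul h : X ≃ᵐ X) ω) := by
  refine map_suspend_eq_withDensity hμ hP (hT h).1.1.absolutelyContinuous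
    (absolutelyContinuous_map_of_mem_Aut (hT h).1) ?_ ?_
  · rw [← compMeasure_smul_inv]
    exact (hT h⁻¹).2
  · rw [← compMeasure_smul_inv]
    exact hχ h⁻¹

theorem quasiMeasurePreserving_smul [SigmaFinite μ] (hP : IsPoissonLaw μ P)
    (hT : ∀ g : G, (MeasurableEquiv.smul g : X ≃ᵐ X) ∈ Aut1 μ)
    (hχ : ∀ g : G, chi μ (MeasurableEquiv.smul g : X ≃ᵐ X) = 0) (h : G) :
    Measure.QuasiMeasurePreserving (fun ω : PoissonSpace μ => h • ω) P P := by
  have := hP.isProbabilityMeasure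
  have hm : Measurable (fun ω : PoissonSpace μ => h • ω) :=
    measurable_suspend (absolutelyContinuous_map_of_mem_Aut (hT h).1)
  refine ⟨hm, ?_⟩
  rcases eq_or_ne μ 0 with hμ | hμ
  · rw [map_eq_self_of_eq_zero hμ hm]
  · rw [map_smul_eq_withDensity hμ hP hT hχ]
    exact withDensity_absolutelyContinuous _ _

theorem ae_tsum_rnDeriv_rpow_eq_top [SigmaFinite μ] (hP : IsPoissonLaw μ P)
    (hT : ∀ g : G, (MeasurableEquiv.smul g : X ≃ᵐ X) ∈ Aut1 μ)
    (hχ : ∀ g : G, chi μ (MeasurableEquiv.smul g : X ≃ᵐ X) = 0) (g : ℕ → G)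
    (hL1 : ∀ k : ℕ, Integrable
      (fun x => (μ.rnDeriv (μ.map (fun y => g k • y)) x).toReal ^ 2 - 1) μ)
    {ϑ : ℝ} (hϑ : 0 < ϑ) {b : ℕ → ℝ} (hb0 : ∀ k, 0 < b k)
    (hb : ∑' k, ENNReal.ofReal (b k) = ∞)
    (hsum : Summable fun k => b k ^ (1 + ϑ) *
      Real.exp (∫ x, ((μ.rnDeriv (μ.map (fun y => g k • y)) x).toReal ^ 2 - 1) ∂μ)) :
    ∀ᵐ ω ∂P, ∑' k, ((P.map (fun ω' => g k • ω')).rnDeriv P ω) ^ (2 / (1 + ϑ)) = ∞ := by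
  have := hP.isProbabilityMeasure
  rcases eq_or_ne μ 0 with hμ | hμ
  -- For `μ = 0` every derivative is one and the series is a sum of ones.
  · have hone : ∀ k, P.map (fun ω' => g k • ω') = P := fun k =>
      map_eq_self_of_eq_zero hμ (quasiMeasurePreserving_smul hP hT hχ (g k)).measurable
    filter_upwards [Measure.rnDeriv_self P] with ω hω
    simp only [hone, hω, ENNReal.one_rpow]
    exact ENNReal.tsum_const_eq_top_of_ne_zero one_ne_zero
  let S : ℕ → X ≃ᵐ X := fun k => MeasurableEquiv.smul (g k)
  have hinv := fun k => lintegral_inv_sq_suspensionDensity hμ hP (S := S k)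
    (absolutelyContinuous_map_of_mem_Aut (hT (g k)).1) (hL1 k)
  have hmul : ∀ k (x : ℝ), ENNReal.ofReal (b k ^ (1 + ϑ) * x) =
      ENNReal.ofReal (b k ^ (1 + ϑ)) * ENNReal.ofReal x := fun k _ =>
    ENNReal.ofReal_mul (Real.rpow_nonneg (hb0 k).le _)
  have hE : ∫⁻ ω, ∑' k, ENNReal.ofReal (b k ^ (1 + ϑ)) *
      ENNReal.ofReal ((suspensionDensity μ (S k) ω ^ 2)⁻¹) ∂P ≠ ∞ := by
    rw [lintegral_tsum fun k => (hinv k).1.const_mul _]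
    simp_rw [fun k => lintegral_const_mul'' (ENNReal.ofReal (b k ^ (1 + ϑ))) (hinv k).1,
      fun k => (hinv k).2, ← hmul]
    exact hsum.tsum_ofReal_ne_top
  have hfin := ae_lt_top' (AEMeasurable.tsum fun k => (hinv k).1.const_mul _) hE
  -- Measurability of `ρ` is recovered from that of `ρ⁻²` by raising to the power `-1/2`.
  have hρm : ∀ k, AEMeasurable (fun ω => ENNReal.ofReal (suspensionDensity μ (S k) ω)) P := by
    intro k
    refine ((hinv k).1.pow_const (-1 / 2 : ℝ)).congr (ae_of_all _ fun ω => ?_)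
    have h0 : 0 < suspensionDensity μ (S k) ω := Real.exp_pos _
    dsimp only
    rw [ENNReal.ofReal_rpow_of_pos (by positivity), ← Real.rpow_natCast, ← Real.rpow_neg h0.le,
      ← Real.rpow_mul h0.le]
    norm_num
  have hrn : ∀ᵐ ω ∂P, ∀ k, (P.map (fun ω' => g k • ω')).rnDeriv P ω =
      ENNReal.ofReal (suspensionDensity μ (S k) ω) := by
    refine ae_all_iff.2 fun k => ?_
    rw [map_smul_eq_withDensity hμ hP hT hχ]
    exact Measure.rnDeriv_withDensity₀ P (hρm k)
  filter_upwards [hfin, hrn] with ω h1 h2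
  simp_rw [h2]
  refine tsum_rpow_eq_top hϑ hb0 (fun k => Real.exp_pos _) hb ?_
  simp_rw [hmul]
  exact h1.ne

end Action

end PoissonSuspension

/-! ### The theorem -/

theorem proposition1p20 {G X : Type*} [Group G] [TopologicalSpace G] [IsTopologicalGroup G]
    [LocallyCompactSpace G] [SecondCountableTopology G] [T2Space G]
    [MeasurableSpace X] [StandardBorelSpace X] [MulAction G X] [MeasurableConstSMul G X]
    (μ : Measure X) [SigmaFinite μ] [NullSingletonClass μ]
    (hT : ∀ g : G, (MeasurableEquiv.smul g : X ≃ᵐ X) ∈ Aut1 μ)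
    (hχ : ∀ g : G, chi μ (MeasurableEquiv.smul g : X ≃ᵐ X) = 0)
    (g : ℕ → G) (hg : IsDispersed g)
    (hL1 : ∀ k : ℕ, Integrable
      (fun x => (μ.rnDeriv (μ.map (fun y => g k • y)) x).toReal ^ 2 - 1) μ)
    (ϑ : ℝ) (hϑ : 0 < ϑ) (b : ℕ → ℝ) (hb0 : ∀ k, 0 < b k) (hb1 : ∀ k, b k ≤ 1)
    (hb : ∑' k, ENNReal.ofReal (b k) = ∞)
    (hsum : Summable fun k => b k ^ (1 + ϑ) *
      Real.exp (∫ x, ((μ.rnDeriv (μ.map (fun y => g k • y)) x).toReal ^ 2 - 1) ∂μ)) :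
    (∀ h : G, Measure.QuasiMeasurePreserving (fun ω : PoissonSpace μ => h • ω)
      (poissonLaw μ) (poissonLaw μ)) ∧
    (∀ᵐ ω ∂(poissonLaw μ), ∑' k,
      (((poissonLaw μ).map (fun ω' => g k • ω')).rnDeriv (poissonLaw μ) ω) ^ (2 / (1 + ϑ)) = ∞) ∧
    (ϑ ≤ 1 → ConservativeAlong (poissonLaw μ) {h : G | ∃ l m : ℕ, l > m ∧ h = g l * (g m)⁻¹}) := by
  have hP := isPoissonLaw_poissonLaw μ
  have := hP.isProbabilityMeasure
  have hq := fun h : G => quasiMeasurePreserving_smul hP hT hχ h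
  have htop := ae_tsum_rnDeriv_rpow_eq_top hP hT hχ g hL1 hϑ hb0 hb hsum
  refine ⟨hq, htop, fun hϑ1 => conservativeAlong_of_tsum_rnDeriv_eq_top hq hg ?_⟩
  filter_upwards [htop] with ω hω
  refine tsum_eq_top_of_tsum_rpow_eq_top ?_ hω
  rw [le_div_iff₀ (by linarith)]
  linarith
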